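/- Let $\mathcal H_S=\mathbb C^n$ with orthonormal energy eigenbasis $|\epsilon_i\rangle$ and $H_S=\sum_i\epsilon_i|\epsilon_i\rangle\langle\epsilon_i|$, $\epsilon_i\in\mathbb R$. Let $\mathcal H_W=L^2(\mathbb R)$ (wave functions $\psi(E)$), let $H_W$ be multiplication by $E$, and let $\Gamma_\epsilon=e^{-i\epsilon\Delta_W}$, $(\Gamma_\epsilon\psi)(E)=\psi(E-\epsilon)$, be the displacement operators, with generator $\Delta_W=-i\,d/dE$. Put $S=e^{-iH_S\otimes\Delta_W}=\sum_i|\epsilon_i\rangle\langle\epsilon_i|\otimes\Gamma_{\epsilon_i}$. Let $V_S$ be a unitary on $\mathcal H_S$ and let $U=S^\dagger V_SS$, which is the general form of a unitary that conserves $H_S+H_W$ and commutes with $\Delta_W$. Let $\rho=\rho_S\otimes\rho_W$ be a product of density operators with $\mathrm{Tr}[H_W^2\rho_W]<\infty$. Write $\langle A\rangle_\rho=\mathrm{Tr}[A\rho]$, $\mathrm{Cov}_\rho[A,B]=\frac12\langle AB+BA\rangle_\rho-\langle A\rangle_\rho\langle B\rangle_\rho$ (products of unbounded operators being understood as quadratic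 forms, $\langle\psi,AB\psi\rangle=\langle A\psi,B\psi\rangle$), $\mathrm{Var}_\rho[A]=\mathrm{Cov}_\rho[A,A]$, and $$\Delta E_W=\langle U^\dagger H_WU\rangle_\rho-\langle H_W\rangle_\rho,\qquad \Delta\sigma_W^2=\mathrm{Var}_\rho[U^\dagger H_WU]-\mathrm{Var}_\rho[H_W].$$ Let $W_S=H_S-V_S^\dagger H_SV_S$, $W_S(t)=e^{iH_St}W_Se^{-iH_St}$, let $\sigma=S\rho S^\dagger$ be the control state and $\sigma_S=\mathrm{Tr}_W[\sigma]$ the control-marginal state, let $$W(E,t)=\frac1{2\pi}\int d\omega\,e^{i\omega t}\,\langle E-\tfrac\omega2|\rho_W|E+\tfrac\omega2\rangle$$ be the Wigner function of the weight, and let $$\xi_S(s)=\frac{\int dt\int dE\,e^{iEs}\,W(E,t)\,e^{-iH_St}\rho_Se^{iH_St}}{\mathrm{Tr}[e^{iH_Ws}\rho_W]}.$$ Then all second moments below are finite, and $$\Delta E_W=\langle W_S\rangle_{\sigma_S},\qquad \Delta\sigma_W^2=\mathrm{Var}_{\sigma_S}[W_S]+2F,\qquad F=\mathrm{Cov}_\sigma[H_S-H_W,\,V_S^\dagger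 H_SV_S].$$ Moreover, $W(\cdot,t)$ is integrable for almost every $t$, the function $t\mapsto\int dE\,e^{iEs}W(E,t)$ is integrable for every $s$, $\xi_S$ is differentiable at $0$, and $$F=-i\,\mathrm{Tr}[W_S\,\xi_S'(0)].$$ Finally, if $E\mapsto(E-\langle H_W\rangle_\rho)\,W(E,t)$ is integrable for almost every $t$ (so that the inner integral below is defined), then the outer integrand is integrable and $$F=\int dt\,\mathrm{Tr}[W_S(t)\rho_S]\int dE\,\bigl[E-\langle H_W\rangle_\rho\bigr]\,W(E,t).$$ -/

import Mathlib

open MeasureTheory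
open scoped ComplexConjugate

noncomputable section

namespace QWeight

/-! ### Mixed states and (possibly unbounded) observables -/

/-- A density operator `ρ = ∑ₖ pₖ |ψₖ⟩⟨ψₖ|` on the Hilbert space `H`, given by a convex
decomposition into pure states (the spectral decomposition, or any other one; the `ψₖ` need not
be orthogonal). By `MixedState.exists_represents` every positive operator of trace one is of
this form. -/
structure MixedState (ι H : Type*) [NormedAddCommGroup H] [InnerProductSpace ℂ H] where
  p : ι → ℝ
  ψ : ι → H
  p_nonneg : ∀ k, 0 ≤ p k
  hasSum_p : HasSum p 1
  norm_ψ : ∀ k, ‖ψ k‖ = 1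

/-- The value of a partially defined operator, extended by `0` outside its domain. -/
def app {H : Type*} [NormedAddCommGroup H] [InnerProductSpace ℂ H]
    (A : H →ₗ.[ℂ] H) (x : H) : H :=
  open Classical in if h : x ∈ A.domain then A ⟨x, h⟩ else 0

/-- A bounded operator, as an everywhere defined unbounded operator. -/
def ofBounded {H : Type*} [NormedAddCommGroup H] [InnerProductSpace ℂ H]
    (T : H →L[ℂ] H) : H →ₗ.[ℂ] H :=
  (T : H →ₗ[ℂ] H).toPMap ⊤

/-- The operator `U† A U`, on the domain `{x | U x ∈ D(A)}`. -/
def heisenberg {H : Type*} [NormedAddCommGroup H] [InnerProductSpace ℂ H] [CompleteSpace H]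
    (U : H →L[ℂ] H) (A : H →ₗ.[ℂ] H) : H →ₗ.[ℂ] H where
  domain := A.domain.comap (U : H →ₗ[ℂ] H)
  toFun := (ContinuousLinearMap.adjoint U : H →ₗ[ℂ] H) ∘ₗ A.toFun ∘ₗ
    ((U : H →ₗ[ℂ] H).restrict (fun _ hx => hx))

namespace MixedState

variable {ι κ H : Type*} [NormedAddCommGroup H] [InnerProductSpace ℂ H]

/-- `T = ∑ₖ pₖ |ψₖ⟩⟨ψₖ|`, strongly convergent. -/
def Represents (ρ : MixedState ι H) (T : H →L[ℂ] H) : Prop :=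
  ∀ x, HasSum (fun k => (ρ.p k : ℂ) • inner ℂ (ρ.ψ k) x • ρ.ψ k) (T x)

/-- Every positive operator of trace one is represented by a mixed state. -/
theorem exists_represents [CompleteSpace H] (b : HilbertBasis ι ℂ H) (T : H →L[ℂ] H)
    (hT : T.IsPositive) (htr : HasSum (fun k => inner ℂ (b k) (T (b k))) 1) :
    ∃ ρ : MixedState ι H, ρ.Represents T := by
  classical
  have h0 : (0 : H →L[ℂ] H) ≤ T := (ContinuousLinearMap.nonneg_iff_isPositive T).2 hT
  set R : H →L[ℂ] H := CFC.sqrt T with hR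
  have hRR : R * R = T := CFC.sqrt_mul_sqrt_self T h0
  have hRsa : IsSelfAdjoint R := IsSelfAdjoint.of_nonneg (CFC.sqrt_nonneg T)
  have hsym : ∀ x y, inner ℂ (R x) y = inner ℂ x (R y) := fun x y => by
    rw [← ContinuousLinearMap.adjoint_inner_right, ContinuousLinearMap.isSelfAdjoint_iff'.1 hRsa]
  have hTR : ∀ x, T x = R (R x) := fun x => by rw [← hRR]; rfl
  have hin : ∀ k, inner ℂ (b k) (T (b k)) = ((‖R (b k)‖ ^ 2 : ℝ) : ℂ) := fun k => by
    rw [hTR, ← hsym, inner_self_eq_norm_sq_to_K]; push_cast; rfl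
  refine ⟨{ p := fun k => ‖R (b k)‖ ^ 2
            ψ := fun k => if R (b k) = 0 then b k else ((‖R (b k)‖⁻¹ : ℝ) : ℂ) • R (b k)
            p_nonneg := fun k => by positivity
            hasSum_p := ?_
            norm_ψ := fun k => ?_ }, fun x => ?_⟩
  · simp_rw [hin] at htr
    rw [← Complex.ofReal_one] at htr
    exact Complex.hasSum_ofReal.1 htr
  · split_ifs with h
    · exact b.orthonormal.1 k
    · rw [norm_smul, Complex.norm_real, norm_inv, norm_norm, inv_mul_cancel₀ (norm_ne_zero_iff.2 h)]
  · have hs := (b.hasSum_repr (R x)).mapL R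
    rw [← hTR] at hs
    convert hs using 1
    funext k
    rw [b.repr_apply_apply, ← hsym, map_smul]
    dsimp only
    split_ifs with h
    · simp [h]
    · have h' : (‖R (b k)‖ : ℂ) ≠ 0 := by exact_mod_cast norm_ne_zero_iff.2 h
      rw [inner_smul_left, smul_smul, smul_smul, Complex.conj_ofReal]
      congr 1
      push_cast
      field_simp

/-- The expectation `⟨A⟩_ρ = Tr[A ρ] = ∑ₖ pₖ ⟨ψₖ, A ψₖ⟩`. -/
def expect (ρ : MixedState ι H) (A : H →ₗ.[ℂ] H) : ℂ :=
  ∑' k, (ρ.p k : ℂ) * inner ℂ (ρ.ψ k) (app A (ρ.ψ k))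

/-- The covariance `½ ⟨A B + B A⟩_ρ - ⟨A⟩_ρ ⟨B⟩_ρ` of two symmetric operators. The products are
read as quadratic forms, `⟨ψ, A B ψ⟩ = ⟨A ψ, B ψ⟩`, so that for unbounded `A`, `B` only
`ψ ∈ D(A) ∩ D(B)` is needed. -/
def cov (ρ : MixedState ι H) (A B : H →ₗ.[ℂ] H) : ℂ :=
  (∑' k, (ρ.p k : ℂ) * ((1 / 2 : ℂ) *
      (inner ℂ (app A (ρ.ψ k)) (app B (ρ.ψ k)) + inner ℂ (app B (ρ.ψ k)) (app A (ρ.ψ k)))))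
    - ρ.expect A * ρ.expect B

/-- The variance `Var_ρ[A] = Cov_ρ[A, A]`. -/
def var (ρ : MixedState ι H) (A : H →ₗ.[ℂ] H) : ℂ := ρ.cov A A

/-- The observable `A` has a finite second moment `Tr[A² ρ] < ∞` in the state `ρ`. -/
def FiniteSecondMoment (ρ : MixedState ι H) (A : H →ₗ.[ℂ] H) : Prop :=
  (∀ k, ρ.p k ≠ 0 → ρ.ψ k ∈ A.domain) ∧ Summable fun k => ρ.p k * ‖app A (ρ.ψ k)‖ ^ 2

/-- The evolved state `S ρ S†`. -/
def map (ρ : MixedState ι H) (S : H ≃ₗᵢ[ℂ] H) : MixedState ι H where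
  p := ρ.p
  ψ k := S (ρ.ψ k)
  p_nonneg := ρ.p_nonneg
  hasSum_p := ρ.hasSum_p
  norm_ψ k := by rw [S.norm_map, ρ.norm_ψ]

end MixedState

/-! ### The weight -/

/-- The Hilbert space `L²(ℝ)` of the weight, in the energy representation `ψ(E) = ⟨E|ψ⟩`. -/
abbrev WeightSpace : Type := Lp ℂ 2 (volume : Measure ℝ)

/-- The maximal domain of the multiplication by `g(E)`. -/
def mulDomain (g : ℝ → ℂ) : Submodule ℂ WeightSpace where
  carrier := {ψ | MemLp (fun E => g E * ψ E) 2 volume}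
  zero_mem' := by
    refine (memLp_congr_ae ?_).2 (MemLp.zero' (α := ℝ) (ε := ℂ))
    filter_upwards [Lp.coeFn_zero ℂ 2 (volume : Measure ℝ)] with E hE
    rw [hE]
    simp
  add_mem' := fun {a b} ha hb => by
    refine (memLp_congr_ae ?_).2 (MemLp.add ha hb)
    filter_upwards [Lp.coeFn_add a b] with E hE
    rw [hE]
    simp [mul_add]
  smul_mem' := fun c a ha => by
    refine (memLp_congr_ae ?_).2 (MemLp.const_smul ha c)
    filter_upwards [Lp.coeFn_smul c a] with E hE
    rw [hE]
    simp [mul_left_comm]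

theorem memLp_of_mem_mulDomain {g : ℝ → ℂ} {ψ : WeightSpace} (h : ψ ∈ mulDomain g) :
    MemLp (fun E => g E * ψ E) 2 volume := h

/-- The function `g(H_W)` of the weight's Hamiltonian: multiplication by `g(E)`, on its maximal
domain. -/
def mulOp (g : ℝ → ℂ) : WeightSpace →ₗ.[ℂ] WeightSpace where
  domain := mulDomain g
  toFun :=
    { toFun := fun ψ => (memLp_of_mem_mulDomain ψ.2).toLp (fun E => g E * (ψ : WeightSpace) E)
      map_add' := fun a b => by
        rw [← MemLp.toLp_add]
        refine MemLp.toLp_congr _ _ ?_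
        filter_upwards [Lp.coeFn_add (a : WeightSpace) b] with E hE
        rw [Submodule.coe_add, hE]
        simp [mul_add]
      map_smul' := fun c a => by
        rw [RingHom.id_apply, ← MemLp.toLp_const_smul]
        refine MemLp.toLp_congr _ _ ?_
        filter_upwards [Lp.coeFn_smul c (a : WeightSpace)] with E hE
        rw [Submodule.coe_smul, hE]
        simp [mul_left_comm] }

/-- The weight's Hamiltonian `H_W = ∫ dE E |E⟩⟨E|`. -/
def weightH : WeightSpace →ₗ.[ℂ] WeightSpace := mulOp fun E => (E : ℂ)

/-- The displacement operator `Γ_ε = exp(-i ε Δ_W)`, `Γ_ε |E⟩ = |E + ε⟩`, that is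
`(Γ_ε ψ)(E) = ψ(E - ε)`; its generator is `Δ_W = -i d/dE`. -/
def displacement (ε : ℝ) : WeightSpace ≃ₗᵢ[ℂ] WeightSpace where
  toFun := Lp.compMeasurePreserving (fun E => E - ε) (measurePreserving_sub_right volume ε)
  invFun := Lp.compMeasurePreserving (fun E => E + ε) (measurePreserving_add_right volume ε)
  map_add' := map_add _
  map_smul' c ψ := (Lp.compMeasurePreservingₗ ℂ (fun E => E - ε)
    (measurePreserving_sub_right volume ε)).map_smul c ψ
  left_inv ψ := by
    have h := (measurePreserving_add_right (volume : Measure ℝ) ε).quasiMeasurePreserving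
    refine Lp.ext ((Lp.coeFn_compMeasurePreserving _ _).trans
      ((h.ae_eq_comp (Lp.coeFn_compMeasurePreserving _ _)).trans ?_))
    exact Filter.Eventually.of_forall fun E => by simp
  right_inv ψ := by
    have h := (measurePreserving_sub_right (volume : Measure ℝ) ε).quasiMeasurePreserving
    refine Lp.ext ((Lp.coeFn_compMeasurePreserving _ _).trans
      ((h.ae_eq_comp (Lp.coeFn_compMeasurePreserving _ _)).trans ?_))
    exact Filter.Eventually.of_forall fun E => by simp
  norm_map' ψ := Lp.norm_compMeasurePreserving ψ _

/-- The kernel `⟨E|ρ_W|E'⟩ = ∑ₖ pₖ ψₖ(E) ψₖ(E')^*`. -/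
def kernel {ι : Type*} (ρW : MixedState ι WeightSpace) (E E' : ℝ) : ℂ :=
  ∑' k, (ρW.p k : ℂ) * (ρW.ψ k E * conj (ρW.ψ k E'))

/-- The Wigner function `W(E,t) = (2π)⁻¹ ∫ dω e^{iωt} ⟨E - ω/2|ρ_W|E + ω/2⟩`. -/
def wigner {ι : Type*} (ρW : MixedState ι WeightSpace) (E t : ℝ) : ℂ :=
  (1 / (2 * Real.pi) : ℂ) *
    ∫ ω : ℝ, Complex.exp (Complex.I * ω * t) * kernel ρW (E - ω / 2) (E + ω / 2)

/-! ### The system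

The system has the Hilbert space `ℂⁿ`, whose standard basis is the energy eigenbasis `|εᵢ⟩`;
operators of the system are matrices in this basis. -/

section System

variable {n κ : Type*} [Fintype n] [DecidableEq n]

/-- The system's Hamiltonian `H_S = ∑ᵢ εᵢ |εᵢ⟩⟨εᵢ|`. -/
def systemH (ε : n → ℝ) : Matrix n n ℂ := Matrix.diagonal fun i => (ε i : ℂ)

/-- The density matrix of a mixed state of the system. -/
def densityMatrix (ρS : MixedState κ (EuclideanSpace ℂ n)) : Matrix n n ℂ :=
  Matrix.of fun i j => ∑' k, (ρS.p k : ℂ) * (ρS.ψ k i * conj (ρS.ψ k j))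

/-- `⟨A⟩_ρ = Tr[A ρ]` for matrices. -/
def matExpect (ρ A : Matrix n n ℂ) : ℂ := (A * ρ).trace

/-- `Cov_ρ[A, B] = ½ ⟨A B + B A⟩_ρ - ⟨A⟩_ρ ⟨B⟩_ρ` for matrices. -/
def matCov (ρ A B : Matrix n n ℂ) : ℂ :=
  (1 / 2 : ℂ) * matExpect ρ (A * B + B * A) - matExpect ρ A * matExpect ρ B

/-- `Var_ρ[A] = Cov_ρ[A, A]` for matrices. -/
def matVar (ρ A : Matrix n n ℂ) : ℂ := matCov ρ A A

/-- The final Hamiltonian `V_S† H_S V_S`. -/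
def finalH (ε : n → ℝ) (V : Matrix n n ℂ) : Matrix n n ℂ :=
  V.conjTranspose * systemH ε * V

/-- The work operator `W_S = H_S - V_S† H_S V_S`. -/
def workOp (ε : n → ℝ) (V : Matrix n n ℂ) : Matrix n n ℂ := systemH ε - finalH ε V

/-- The free evolution `e^{-i H_S t}`. -/
def freeEvol (ε : n → ℝ) (t : ℝ) : Matrix n n ℂ :=
  NormedSpace.exp ((-(Complex.I * t)) • systemH ε)

/-- The Heisenberg-picture work operator `W_S(t) = e^{i H_S t} W_S e^{-i H_S t}`. -/
def workOpAt (ε : n → ℝ) (V : Matrix n n ℂ) (t : ℝ) : Matrix n n ℂ :=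
  freeEvol ε (-t) * workOp ε V * freeEvol ε t

/-- The operator
`ξ_S(s) = (∫ dt ∫ dE e^{iEs} W(E,t) e^{-i H_S t} ρ_S e^{i H_S t}) / Tr[e^{i H_W s} ρ_W]`
(matrix-valued integrals are taken entrywise). -/
def xi {ι : Type*} (ε : n → ℝ) (ρS : MixedState κ (EuclideanSpace ℂ n))
    (ρW : MixedState ι WeightSpace) (s : ℝ) : Matrix n n ℂ :=
  Matrix.of fun i j =>
    (∫ t : ℝ, ∫ E : ℝ, Complex.exp (Complex.I * E * s) * wigner ρW E t *
        (freeEvol ε t * densityMatrix ρS * freeEvol ε (-t)) i j) /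
      ρW.expect (mulOp fun E => Complex.exp (Complex.I * E * s))

/-- The entrywise derivative `ξ_S'(0)`. -/
def xiDerivZero {ι : Type*} (ε : n → ℝ) (ρS : MixedState κ (EuclideanSpace ℂ n))
    (ρW : MixedState ι WeightSpace) : Matrix n n ℂ :=
  Matrix.of fun i j => deriv (fun s => xi ε ρS ρW s i j) 0

end System

/-! ### The composite system -/

/-- The composite Hilbert space `ℂⁿ ⊗ L²(ℝ)`, as the Hilbert sum of copies of `L²(ℝ)`: the vector
`∑ᵢ |εᵢ⟩ ⊗ Ψᵢ` is the family `(Ψᵢ)ᵢ`. -/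
abbrev TotalSpace (n : Type*) : Type _ := PiLp 2 fun _ : n => WeightSpace

section Composite

variable {n κ ι : Type*} [Fintype n]

/-- The product vector `v ⊗ ψ`. -/
def tensor (v : EuclideanSpace ℂ n) (ψ : WeightSpace) : TotalSpace n :=
  WithLp.toLp 2 fun i => v i • ψ

theorem norm_tensor (v : EuclideanSpace ℂ n) (ψ : WeightSpace) :
    ‖tensor v ψ‖ = ‖v‖ * ‖ψ‖ := by
  rw [PiLp.norm_eq_of_L2, EuclideanSpace.norm_eq, ← Real.sqrt_sq (norm_nonneg ψ),
    ← Real.sqrt_mul (Finset.sum_nonneg fun _ _ => by positivity), Finset.sum_mul]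
  simp [tensor, norm_smul, mul_pow]

/-- The product state `ρ_S ⊗ ρ_W`. -/
def prodState (ρS : MixedState κ (EuclideanSpace ℂ n)) (ρW : MixedState ι WeightSpace) :
    MixedState (κ × ι) (TotalSpace n) where
  p k := ρS.p k.1 * ρW.p k.2
  ψ k := tensor (ρS.ψ k.1) (ρW.ψ k.2)
  p_nonneg k := mul_nonneg (ρS.p_nonneg _) (ρW.p_nonneg _)
  hasSum_p := by
    have hs := ρS.hasSum_p.summable.mul_of_nonneg ρW.hasSum_p.summable ρS.p_nonneg ρW.p_nonneg
    have h := HasSum.mul ρS.hasSum_p ρW.hasSum_p hs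
    rwa [one_mul] at h
  norm_ψ k := by rw [norm_tensor, ρS.norm_ψ, ρW.norm_ψ, one_mul]

/-- The operator `M ⊗ 1` for a matrix `M` of the system: `(M Ψ)ᵢ = ∑ⱼ Mᵢⱼ Ψⱼ`. -/
def onSystem (M : Matrix n n ℂ) : TotalSpace n →L[ℂ] TotalSpace n :=
  (PiLp.continuousLinearEquiv 2 ℂ fun _ : n => WeightSpace).symm.toContinuousLinearMap ∘L
    ContinuousLinearMap.pi fun i => ∑ j, M i j • PiLp.proj 2 (fun _ : n => WeightSpace) j

/-- The operator `1 ⊗ A` for an operator `A` of the weight, `(A Ψ)ᵢ = A Ψᵢ`. -/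
def onWeight (A : WeightSpace →ₗ.[ℂ] WeightSpace) : TotalSpace n →ₗ.[ℂ] TotalSpace n where
  domain :=
    { carrier := {Ψ | ∀ i, Ψ i ∈ A.domain}
      zero_mem' := fun _ => A.domain.zero_mem
      add_mem' := fun ha hb i => A.domain.add_mem (ha i) (hb i)
      smul_mem' := fun c _ ha i => A.domain.smul_mem c (ha i) }
  toFun :=
    { toFun := fun Ψ => WithLp.toLp 2 fun i => A ⟨(Ψ : TotalSpace n) i, Ψ.2 i⟩
      map_add' := fun a b => by
        ext1 i
        exact A.map_add ⟨(a : TotalSpace n) i, a.2 i⟩ ⟨(b : TotalSpace n) i, b.2 i⟩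
      map_smul' := fun c a => by
        ext1 i
        exact A.map_smul c ⟨(a : TotalSpace n) i, a.2 i⟩ }

variable [DecidableEq n]

/-- `S = exp(-i H_S ⊗ Δ_W) = ∑ᵢ |εᵢ⟩⟨εᵢ| ⊗ Γ_{εᵢ}`, that is `S |εᵢ, E⟩ = |εᵢ, E + εᵢ⟩`. -/
def controlS (ε : n → ℝ) : TotalSpace n ≃ₗᵢ[ℂ] TotalSpace n :=
  LinearIsometryEquiv.piLpCongrRight 2 fun i => displacement (ε i)

/-- The energy-conserving and translation-invariant unitary `U = S† V_S S`. -/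
def totalU (ε : n → ℝ) (V : Matrix n n ℂ) : TotalSpace n →L[ℂ] TotalSpace n :=
  ((controlS ε).symm : TotalSpace n →L[ℂ] TotalSpace n) ∘L onSystem V ∘L
    (controlS ε : TotalSpace n →L[ℂ] TotalSpace n)

/-- The partial trace `Tr_W` of a state: `⟨εᵢ| Tr_W |Ψ⟩⟨Ψ| |εⱼ⟩ = ⟨Ψⱼ, Ψᵢ⟩`. -/
def reducedS (ρ : MixedState ι (TotalSpace n)) : Matrix n n ℂ :=
  Matrix.of fun i j => ∑' k, (ρ.p k : ℂ) * inner ℂ (ρ.ψ k j) (ρ.ψ k i)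

/-- The control state `σ = S (ρ_S ⊗ ρ_W) S†`. -/
def controlState (ε : n → ℝ) (ρS : MixedState κ (EuclideanSpace ℂ n))
    (ρW : MixedState ι WeightSpace) : MixedState (κ × ι) (TotalSpace n) :=
  (prodState ρS ρW).map (controlS ε)

/-- The control-marginal state `σ_S = Tr_W[σ]`. -/
def controlMarginal (ε : n → ℝ) (ρS : MixedState κ (EuclideanSpace ℂ n))
    (ρW : MixedState ι WeightSpace) : Matrix n n ℂ :=
  reducedS (controlState ε ρS ρW)

/-- `ΔE_W = ⟨U† H_W U⟩_ρ - ⟨H_W⟩_ρ` with `ρ = ρ_S ⊗ ρ_W`. -/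
def deltaE (ε : n → ℝ) (V : Matrix n n ℂ) (ρS : MixedState κ (EuclideanSpace ℂ n))
    (ρW : MixedState ι WeightSpace) : ℂ :=
  (prodState ρS ρW).expect (heisenberg (totalU ε V) (onWeight weightH))
    - (prodState ρS ρW).expect (onWeight weightH)

/-- `Δσ_W² = Var_ρ[U† H_W U] - Var_ρ[H_W]` with `ρ = ρ_S ⊗ ρ_W`. -/
def deltaVar (ε : n → ℝ) (V : Matrix n n ℂ) (ρS : MixedState κ (EuclideanSpace ℂ n))
    (ρW : MixedState ι WeightSpace) : ℂ :=
  (prodState ρS ρW).var (heisenberg (totalU ε V) (onWeight weightH))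
    - (prodState ρS ρW).var (onWeight weightH)

/-- `F = Cov_σ[H_S - H_W, V_S† H_S V_S]`. -/
def fTerm (ε : n → ℝ) (V : Matrix n n ℂ) (ρS : MixedState κ (EuclideanSpace ℂ n))
    (ρW : MixedState ι WeightSpace) : ℂ :=
  (controlState ε ρS ρW).cov (ofBounded (onSystem (systemH ε)) - onWeight weightH)
    (ofBounded (onSystem (finalH ε V)))

end Composite

end QWeight

end

noncomputable section

namespace QWeight

open FourierTransform Filter Topology

/-! ### The Fourier transform on `L¹ ∩ L²` -/

/-! Algebraic half. Since `H_W Γ_a = Γ_a (H_W + a)`, one has `S† H_W S = H_W + H_S`; as `V_S`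
commutes with `H_W`, this gives `U† H_W U = H_W + S† W_S S` (`app_heisenberg`) and `(H_S - H_W) S =
-S H_W` (`app_systemH_sub_weightH`). In a product state `S` only translates the `i`-th component by
`εᵢ`. Every expectation except `⟨H_W²⟩` therefore becomes a finite sum `T(M, g) = ∑ᵢⱼ Mᵢⱼ (ρ_S)ⱼᵢ
g(εⱼ - εᵢ)` (`weightedTrace`), or a value `g(0)`, where `g` is `o = overlap ρW` or `e =
energyOverlap ρW`. Expanding the square, `⟨H_W²⟩` cancels from `Δσ_W²`, leaving `T(W_S², o) - T(W_S,
o)² + 2 (T(W_S, e) - e(0) T(W_S, o))`. The last bracket is `F` (`fTerm_eq_weightedTrace`): the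
diagonal `H_S` contributes nothing to it because `o(0) = 1`.

Analytic half. In the coordinates `E ∓ ω/2` each pure-state term of the Wigner double integral is a
product, so `∫ dE e^{iEs} W(E,t)` is, up to scaling, `∑ₖ pₖ 𝓕(e^{isE/2} ψₖ) · conj 𝓕(e^{-isE/2} ψₖ)`
(`wignerTransform_eq`). Fubini applies because `ψₖ ∈ D(H_W)` forces `ψₖ ∈ L¹` with a bound summable
against `pₖ`. A product of two `L²` functions lies in `L¹`, and `s ↦ e^{isH_W} ψₖ` is differentiable
in `L²` at `0`; hence the transform is an `L¹`-valued curve differentiable at `0`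
(`hasDerivAt_wignerCurve`), even if no first moment of `W(·,t)` converges. By Parseval its Fourier
coefficient at `ω` has value `o(ω)` and derivative `i e(ω)` at `s = 0`. The entries of `ξ_S` are
quotients of such coefficients, which yields `F = -i Tr[W_S ξ_S'(0)]`. If the first moment does
converge for almost every `t`, it is the pointwise derivative of the transform, and must agree
almost everywhere with the `L¹` derivative (`wignerCurveDeriv_ae_eq`); taking Fourier coefficients
gives the Wigner form of `F`. -/

/-- On `L¹ ∩ L²` the Fourier transform of `L²` is given by the Fourier integral. -/
theorem coeFn_fourier_ae_eq (f : WeightSpace) (hf : Integrable f) :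
    ((𝓕 f : WeightSpace) : ℝ → ℂ) =ᵐ[volume] 𝓕 (f : ℝ → ℂ) := by
  have hcont : Continuous (𝓕 (f : ℝ → ℂ)) :=
    VectorFourier.fourierIntegral_continuous Real.continuous_fourierChar (by fun_prop) hf
  -- Both sides are compared against smooth compactly supported `g`. On the left the transform
  -- passes to `g` through tempered distributions, on the right through the self-adjointness of the
  -- Fourier integral.
  refine ae_eq_of_integral_contDiff_smul_eq ((Lp.memLp _).locallyIntegrable (by norm_num))
    hcont.locallyIntegrable fun g hg hgc => ?_
  have hg₁ : HasCompactSupport (Complex.ofRealCLM ∘ g) := hgc.comp_left rfl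
  have hg₂ : ContDiff ℝ (⊤ : ℕ∞) (Complex.ofRealCLM ∘ g) := by fun_prop
  set G := hg₁.toSchwartzMap hg₂ with hG
  have h1 := congrArg (fun T => T G) (Lp.fourier_toTemperedDistribution_eq f)
  simp only [TemperedDistribution.fourier_apply, Lp.toTemperedDistribution_apply] at h1
  have h2 := VectorFourier.integral_fourierIntegral_smul_eq_flip (L := innerₗ ℝ)
    Real.continuous_fourierChar (by fun_prop) (G.integrable (μ := volume)) hf
  have h3 : ∀ x, G x = (g x : ℂ) := fun x => rfl
  simp only [h3] at h1
  have h4 : ∀ x, g x • ((𝓕 f : WeightSpace) : ℝ → ℂ) x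
    = (g x : ℂ) • ((𝓕 f : WeightSpace) : ℝ → ℂ) x := fun x => by simp
  have h5 : ∀ x, g x • (𝓕 (f : ℝ → ℂ)) x = (g x : ℂ) • (𝓕 (f : ℝ → ℂ)) x := fun x => by simp
  simp only [h4, h5]
  rw [← h1, SchwartzMap.fourier_coe]
  refine h2.trans ?_
  simp only [flip_innerₗ, h3]
  rfl

/-- The real-bilinear form `x · conj y` on `ℂ`. -/
def mulConj : ℂ →L[ℝ] ℂ →L[ℝ] ℂ :=
  (ContinuousLinearMap.mul ℝ ℂ).bilinearComp (ContinuousLinearMap.id ℝ ℂ)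
    (Complex.conjCLE : ℂ →L[ℝ] ℂ)

theorem norm_mulConj_le : ‖mulConj‖ ≤ 1 :=
  ContinuousLinearMap.opNorm_le_bound₂ _ zero_le_one fun x y => by simp [mulConj]

/-- The product `𝓕 f · conj (𝓕 h)` of two Fourier transforms, as a continuous real-bilinear map
from `L²` to `L¹`. -/
def fourierPairing : WeightSpace →L[ℝ] WeightSpace →L[ℝ] Lp ℂ 1 (volume : Measure ℝ) :=
  (mulConj.holderL volume 2 2 1).bilinearComp
    ((Lp.fourierTransformₗᵢ ℝ ℂ : WeightSpace →L[ℂ] WeightSpace).restrictScalars ℝ)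
    ((Lp.fourierTransformₗᵢ ℝ ℂ : WeightSpace →L[ℂ] WeightSpace).restrictScalars ℝ)

theorem fourierPairing_apply (f h : WeightSpace) :
    fourierPairing f h = mulConj.holder 1 (𝓕 f : WeightSpace) (𝓕 h : WeightSpace) := rfl

theorem coeFn_fourierPairing_of_integrable {f h : WeightSpace} (hf : Integrable f)
    (hh : Integrable h) : fourierPairing f h =ᵐ[volume]
    fun τ => 𝓕 (f : ℝ → ℂ) τ * conj (𝓕 (h : ℝ → ℂ) τ) := by
  filter_upwards [mulConj.coeFn_holder (r := 1) (𝓕 f : WeightSpace) (𝓕 h : WeightSpace),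
    coeFn_fourier_ae_eq f hf, coeFn_fourier_ae_eq h hh] with τ h1 h2 h3
  rw [fourierPairing_apply, h1, h2, h3]
  rfl

theorem norm_fourierPairing_le (f h : WeightSpace) : ‖fourierPairing f h‖ ≤ ‖f‖ * ‖h‖ := by
  refine (mulConj.norm_holder_apply_apply_le (r := 1)
    (𝓕 f : WeightSpace) (𝓕 h : WeightSpace)).trans ?_
  rw [Lp.norm_fourier_eq, Lp.norm_fourier_eq, mul_assoc]
  exact mul_le_of_le_one_left (by positivity) norm_mulConj_le

/-! ### Displacements and modulations -/

theorem coeFn_displacement (ε : ℝ) (ψ : WeightSpace) :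
    displacement ε ψ =ᵐ[volume] fun E => ψ (E - ε) :=
  Lp.coeFn_compMeasurePreserving _ _

theorem displacement_zero (ψ : WeightSpace) : displacement 0 ψ = ψ := by
  refine Lp.ext ((coeFn_displacement 0 ψ).trans ?_)
  simp

theorem displacement_add (a b : ℝ) (ψ : WeightSpace) :
    displacement a (displacement b ψ) = displacement (a + b) ψ := by
  have h := (measurePreserving_sub_right (volume : Measure ℝ) a).quasiMeasurePreserving
  refine Lp.ext ((coeFn_displacement _ _).trans
      ((h.ae_eq_comp (coeFn_displacement b ψ)).trans ((coeFn_displacement _ _).trans ?_).symm))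
  exact Eventually.of_forall fun E => by simp [sub_sub]

theorem displacement_symm (a : ℝ) (ψ : WeightSpace) :
    (displacement a).symm ψ = displacement (-a) ψ := by
  rw [LinearIsometryEquiv.symm_apply_eq, displacement_add, add_neg_cancel, displacement_zero]

theorem inner_displacement_displacement (a b : ℝ) (f g : WeightSpace) :
    inner ℂ (displacement a f) (displacement b g) = inner ℂ (displacement (a - b) f) g := by
  rw [← (displacement (-b)).inner_map_map, displacement_add, displacement_add, neg_add_cancel,
    displacement_zero, neg_add_eq_sub]

theorem memLp_phase_mul (s : ℝ) (ψ : WeightSpace) :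
    MemLp (fun E : ℝ => Complex.exp (Complex.I * E * s) * ψ E) 2 volume := by
  refine (Lp.memLp ψ).of_le (AEStronglyMeasurable.mul (by fun_prop)
    (Lp.aestronglyMeasurable ψ)) (Eventually.of_forall fun E => ?_)
  rw [norm_mul, show Complex.I * E * s = ((E * s : ℝ) : ℂ) * Complex.I by push_cast; ring,
    Complex.norm_exp_ofReal_mul_I, one_mul]

/-- The modulation `e^{i s H_W}`. -/
def modulation (s : ℝ) (ψ : WeightSpace) : WeightSpace := (memLp_phase_mul s ψ).toLp _

theorem coeFn_modulation (s : ℝ) (ψ : WeightSpace) :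
    modulation s ψ =ᵐ[volume] fun E : ℝ => Complex.exp (Complex.I * E * s) * ψ E :=
  MemLp.coeFn_toLp _

theorem modulation_zero (ψ : WeightSpace) : modulation 0 ψ = ψ := by
  refine Lp.ext ((coeFn_modulation 0 ψ).trans ?_)
  simp

theorem norm_exp_phase (E s : ℝ) : ‖Complex.exp (Complex.I * E * s)‖ = 1 := by
  rw [show Complex.I * E * s = ((E * s : ℝ) : ℂ) * Complex.I by push_cast; ring,
    Complex.norm_exp_ofReal_mul_I]

theorem norm_modulation (s : ℝ) (ψ : WeightSpace) : ‖modulation s ψ‖ = ‖ψ‖ := by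
  rw [Lp.norm_def, Lp.norm_def]
  congr 1
  refine eLpNorm_congr_norm_ae ?_
  filter_upwards [coeFn_modulation s ψ] with E hE
  rw [hE, norm_mul, norm_exp_phase, one_mul]

theorem integrable_modulation {ψ : WeightSpace} (hψ : Integrable ψ) (s : ℝ) :
    Integrable (modulation s ψ) := by
  refine (integrable_congr (coeFn_modulation s ψ)).2 (hψ.bdd_mul (c := 1) (by fun_prop) ?_)
  exact Eventually.of_forall fun E => (norm_exp_phase E s).le

theorem app_of_mem {H : Type*} [NormedAddCommGroup H] [InnerProductSpace ℂ H]
    {A : H →ₗ.[ℂ] H} {x : H} (h : x ∈ A.domain) : app A x = A ⟨x, h⟩ := dif_pos h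

theorem coeFn_app_mulOp {g : ℝ → ℂ} {ψ : WeightSpace} (h : ψ ∈ (mulOp g).domain) :
    (app (mulOp g) ψ : WeightSpace) =ᵐ[volume] fun E => g E * ψ E := by
  rw [app_of_mem h]
  exact MemLp.coeFn_toLp (memLp_of_mem_mulDomain h)

theorem app_mulOp_phase (s : ℝ) (ψ : WeightSpace) :
    app (mulOp fun E : ℝ => Complex.exp (Complex.I * E * s)) ψ = modulation s ψ :=
  app_of_mem (memLp_phase_mul s ψ)

/-- The energy `H_W ψ`, extended by `0` outside the domain of `H_W`. -/
abbrev energy (ψ : WeightSpace) : WeightSpace := app weightH ψ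

theorem coeFn_energy {ψ : WeightSpace} (h : ψ ∈ weightH.domain) :
    energy ψ =ᵐ[volume] fun E => (E : ℂ) * ψ E := coeFn_app_mulOp h

theorem norm_modulation_sub_le {ψ : WeightSpace} (h : ψ ∈ weightH.domain) (s : ℝ) :
    ‖modulation s ψ - ψ‖ ≤ |s| * ‖energy ψ‖ := by
  have : ‖(s : ℂ) • energy ψ‖ = |s| * ‖energy ψ‖ := by rw [norm_smul, Complex.norm_real]; rfl
  rw [← this]
  refine Lp.norm_le_norm_of_ae_le ?_
  filter_upwards [coeFn_modulation s ψ, coeFn_energy h, Lp.coeFn_sub (modulation s ψ) ψ,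
    Lp.coeFn_smul (s : ℂ) (energy ψ)] with E h1 h2 h3 h4
  rw [h3, h4, Pi.sub_apply, Pi.smul_apply, h1, h2, smul_eq_mul, ← sub_one_mul, norm_mul,
    ← mul_assoc, norm_mul]
  gcongr
  have := Real.norm_exp_I_mul_ofReal_sub_one_le (x := E * s)
  rw [norm_mul]
  refine le_trans (le_of_eq ?_) (this.trans (le_of_eq ?_))
  · push_cast; ring_nf
  · rw [norm_mul, mul_comm, Complex.norm_real, Complex.norm_real]

theorem norm_sq_eq_integral (f : WeightSpace) : ‖f‖ ^ 2 = ∫ E, ‖f E‖ ^ 2 := by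
  have h := inner_self_eq_norm_sq_to_K (𝕜 := ℂ) f
  rw [L2.inner_def] at h
  simp only [inner_self_eq_norm_sq_to_K] at h
  have h2 : ∀ E : ℝ, ((‖f E‖ : ℂ)) ^ 2 = ((‖f E‖ ^ 2 : ℝ) : ℂ) := fun E => by push_cast; rfl
  have h3 : (∫ E, ((‖f E‖ ^ 2 : ℝ) : ℂ)) = ((‖f‖ ^ 2 : ℝ) : ℂ) := by
    rw [Complex.ofReal_pow]
    exact (integral_congr_ae (Eventually.of_forall fun E => (h2 E).symm)).trans h
  rw [integral_complex_ofReal] at h3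
  exact_mod_cast h3.symm

theorem integrable_norm_sq (f : WeightSpace) : Integrable fun E => ‖f E‖ ^ 2 :=
  (Lp.memLp f).norm.integrable_sq

/-- `H_W` generates the modulations: `d/ds e^{i s H_W} ψ = i H_W ψ` at `s = 0`. -/
theorem hasDerivAt_modulation_zero {ψ : WeightSpace} (h : ψ ∈ weightH.domain) :
    HasDerivAt (fun s => modulation s ψ) (Complex.I • energy ψ) 0 := by
  rw [hasDerivAt_iff_tendsto_slope_zero]
  simp only [zero_add, modulation_zero]
  rw [tendsto_iff_norm_sub_tendsto_zero]
  have hsq : Tendsto (fun t : ℝ => ‖t⁻¹ • (modulation t ψ - ψ) - Complex.I • energy ψ‖ ^ 2)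
      (𝓝[≠] 0) (𝓝 0) := by
    have hint : ∀ t : ℝ, ‖t⁻¹ • (modulation t ψ - ψ) - Complex.I • energy ψ‖ ^ 2 =
        ∫ E : ℝ, ‖t⁻¹ • (Complex.exp (Complex.I * E * t) * ψ E - ψ E)
          - Complex.I • ((E : ℂ) * ψ E)‖ ^ 2 := fun t => by
      rw [norm_sq_eq_integral]
      refine integral_congr_ae ?_
      filter_upwards [coeFn_modulation t ψ, coeFn_energy h, Lp.coeFn_sub (modulation t ψ) ψ,
        Lp.coeFn_smul Complex.I (energy ψ), Lp.coeFn_smul t⁻¹ (modulation t ψ - ψ),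
        Lp.coeFn_sub (t⁻¹ • (modulation t ψ - ψ)) (Complex.I • energy ψ)] with E h1 h2 h3 h4 h5 h6
      rw [h6, Pi.sub_apply, h4, h5, Pi.smul_apply, h3, Pi.sub_apply, h1, Pi.smul_apply, h2]
    simp only [hint]
    rw [show 𝓝 (0 : ℝ) = 𝓝 (∫ E : ℝ, (0 : ℝ)) by simp]
    -- By `|e^{ix} - 1| ≤ |x|` the difference quotient is at most `|E ψ|`, as is its limit; hence
    -- the majorant `(2 |E ψ|)²`.
    refine tendsto_integral_filter_of_dominated_convergence (fun E => 4 * ‖energy ψ E‖ ^ 2)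
      (Eventually.of_forall fun t => ?_) (eventually_mem_nhdsWithin.mono fun t ht => ?_)
      ((integrable_norm_sq _).const_mul 4) (Eventually.of_forall fun E => ?_)
    · have := Lp.aestronglyMeasurable ψ
      have h2 : AEStronglyMeasurable (fun E : ℝ => Complex.exp (Complex.I * E * t)) volume := by
        fun_prop
      have h3 : AEStronglyMeasurable (fun E : ℝ => (E : ℂ)) volume := by fun_prop
      exact (((((h2.mul this).sub this).const_smul t⁻¹).sub
        ((h3.mul this).const_smul Complex.I)).norm).pow 2
    · filter_upwards [coeFn_energy h] with E hE
      have ht' : t ≠ 0 := ht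
      rw [hE]
      have hb := Real.norm_exp_I_mul_ofReal_sub_one_le (x := E * t)
      have hb' : ‖t⁻¹ • (Complex.exp (Complex.I * E * t) * ψ E - ψ E)‖ ≤ ‖(E : ℂ) * ψ E‖ := by
        rw [← sub_one_mul, norm_smul, norm_mul, norm_mul, ← mul_assoc]
        gcongr
        rw [show Complex.I * E * t = Complex.I * ((E * t : ℝ) : ℂ) by push_cast; ring]
        calc ‖t⁻¹‖ * _ ≤ ‖t⁻¹‖ * ‖E * t‖ := by gcongr
          _ = ‖(E : ℂ)‖ := by
            rw [norm_mul, norm_inv, Complex.norm_real]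
            have : ‖t‖ ≠ 0 := norm_ne_zero_iff.2 ht'
            field_simp
      have h2 : ‖Complex.I • ((E : ℂ) * ψ E)‖ = ‖(E : ℂ) * ψ E‖ := by simp
      rw [Real.norm_of_nonneg (by positivity)]
      calc _ ≤ (‖(E : ℂ) * ψ E‖ + ‖(E : ℂ) * ψ E‖) ^ 2 := by
            gcongr
            exact (norm_sub_le _ _).trans (add_le_add hb' h2.le)
        _ = _ := by ring
    · have hd : HasDerivAt (fun t : ℝ => Complex.exp (Complex.I * E * t) * ψ E)
          (Complex.I • ((E : ℂ) * ψ E)) 0 := by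
        have h1 : HasDerivAt (fun t : ℝ => Complex.I * E * (t : ℂ)) (Complex.I * E) 0 := by
          simpa using (Complex.ofRealCLM.hasDerivAt (x := (0 : ℝ))).const_mul (Complex.I * E)
        have h2 := (h1.cexp).mul_const (ψ E)
        simpa [mul_assoc] using h2
      rw [hasDerivAt_iff_tendsto_slope_zero] at hd
      simp only [zero_add, Complex.ofReal_zero, mul_zero, Complex.exp_zero, one_mul] at hd
      simpa using ((tendsto_iff_norm_sub_tendsto_zero.1 hd).pow 2)
  have := hsq.sqrt
  simpa using this

/-! ### Integrability of wave functions with finite energy -/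

/-- Weighted AM-GM: `|ψ| ≤ (r/2)(1 + E²)⁻¹ + (1 + E²)|ψ|² / (2r)`. With `r² = 1 + ‖H_W ψ‖²` the
right side integrates to `(π + 1) r / 2`, which is at most `3r`. A bound on the squared `L¹` norm
that is linear in `‖H_W ψ‖²` is what the second moment can sum. -/
theorem integrable_and_integral_norm_le {ψ : WeightSpace} (h : ψ ∈ weightH.domain)
    (hψ : ‖ψ‖ = 1) : Integrable ψ ∧ (∫ E, ‖ψ E‖) ^ 2 ≤ 9 * (1 + ‖energy ψ‖ ^ 2) := by
  set r := √(1 + ‖energy ψ‖ ^ 2) with hr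
  have hr2 : r ^ 2 = 1 + ‖energy ψ‖ ^ 2 := Real.sq_sqrt (by positivity)
  have hrpos : 0 < r := Real.sqrt_pos.2 (by positivity)
  have hint : Integrable fun E : ℝ => r / 2 * (1 + E ^ 2)⁻¹ +
      1 / (2 * r) * (‖ψ E‖ ^ 2 + ‖energy ψ E‖ ^ 2) :=
    (integrable_inv_one_add_sq.const_mul _).add
      (((integrable_norm_sq ψ).add (integrable_norm_sq _)).const_mul _)
  have hle : ∀ᵐ E : ℝ, ‖ψ E‖ ≤ r / 2 * (1 + E ^ 2)⁻¹ +
      1 / (2 * r) * (‖ψ E‖ ^ 2 + ‖energy ψ E‖ ^ 2) := by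
    filter_upwards [coeFn_energy h] with E hE
    have hE2 : ‖energy ψ E‖ ^ 2 = E ^ 2 * ‖ψ E‖ ^ 2 := by
      rw [hE, norm_mul, mul_pow, Complex.norm_real, Real.norm_eq_abs, sq_abs]
    rw [hE2]
    have hp : 0 < 1 + E ^ 2 := by positivity
    have key : r / 2 * (1 + E ^ 2)⁻¹ + 1 / (2 * r) * (‖ψ E‖ ^ 2 + E ^ 2 * ‖ψ E‖ ^ 2) - ‖ψ E‖
        = (r - (1 + E ^ 2) * ‖ψ E‖) ^ 2 / (2 * r * (1 + E ^ 2)) := by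
      field_simp
      ring
    have : 0 ≤ (r - (1 + E ^ 2) * ‖ψ E‖) ^ 2 / (2 * r * (1 + E ^ 2)) := by positivity
    linarith
  have hψi : Integrable ψ := hint.mono' (Lp.aestronglyMeasurable ψ) hle
  refine ⟨hψi, ?_⟩
  have h1 : ∫ E, ‖ψ E‖ ≤ (Real.pi + 1) / 2 * r := by
    refine (integral_mono_ae hψi.norm hint hle).trans (le_of_eq ?_)
    have hi : Integrable fun E => 1 / (2 * r) * (‖ψ E‖ ^ 2 + ‖energy ψ E‖ ^ 2) :=
      ((integrable_norm_sq ψ).add (integrable_norm_sq _)).const_mul _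
    rw [integral_add (integrable_inv_one_add_sq.const_mul _) hi,
      integral_const_mul, integral_const_mul, integral_univ_inv_one_add_sq,
      integral_add (integrable_norm_sq ψ) (integrable_norm_sq _), ← norm_sq_eq_integral,
      ← norm_sq_eq_integral, hψ, one_pow, ← hr2]
    field_simp
  have h0 : 0 ≤ ∫ E, ‖ψ E‖ := integral_nonneg fun _ => norm_nonneg _
  have h3 : ∫ E, ‖ψ E‖ ≤ 3 * r := h1.trans (by nlinarith [Real.pi_lt_four])
  calc (∫ E, ‖ψ E‖) ^ 2 ≤ (3 * r) ^ 2 := by gcongr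
    _ = _ := by rw [mul_pow, hr2]; norm_num

/-! ### Center-of-mass coordinates -/

/-- The map is a composition of two shears, up to swaps of the coordinates. -/
theorem measurePreserving_sub_half_add_half :
    MeasurePreserving (fun z : ℝ × ℝ => (z.1 - z.2 / 2, z.1 + z.2 / 2)) := by
  have h1 : MeasurePreserving (fun z : ℝ × ℝ => (z.1, z.2 - z.1 / 2))
      (volume.prod volume) (volume.prod volume) :=
    (MeasurePreserving.id volume).skew_product (g := fun ω E => E - ω / 2)
      (by simp only [Function.uncurry_def]; fun_prop)
      (Eventually.of_forall fun ω => (measurePreserving_sub_right volume (ω / 2)).map_eq)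
  have h2 : MeasurePreserving (fun z : ℝ × ℝ => (z.1, z.2 + z.1))
      (volume.prod volume) (volume.prod volume) :=
    (MeasurePreserving.id volume).skew_product (g := fun x ω => ω + x)
      (by simp only [Function.uncurry_def]; fun_prop)
      (Eventually.of_forall fun x => (measurePreserving_add_right volume x).map_eq)
  have hs : MeasurePreserving (Prod.swap : ℝ × ℝ → ℝ × ℝ) (volume.prod volume)
    (volume.prod volume) := Measure.measurePreserving_swap
  have h := h2.comp (hs.comp (h1.comp hs))
  have he : (fun z : ℝ × ℝ => (z.1, z.2 + z.1)) ∘ Prod.swap ∘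
      (fun z : ℝ × ℝ => (z.1, z.2 - z.1 / 2)) ∘ Prod.swap =
      fun z : ℝ × ℝ => (z.1 - z.2 / 2, z.1 + z.2 / 2) := by
    funext z
    simp only [Function.comp_apply, Prod.swap, Prod.mk.injEq, true_and]
    ring
  rw [he] at h
  exact h

theorem integrable_sub_half_add_half {𝕜 : Type*} [RCLike 𝕜] {a b : ℝ → 𝕜}
    (ha : Integrable a) (hb : Integrable b) :
    Integrable fun z : ℝ × ℝ => a (z.1 - z.2 / 2) * b (z.1 + z.2 / 2) :=
  measurePreserving_sub_half_add_half.integrable_comp_of_integrable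
    (g := fun z : ℝ × ℝ => a z.1 * b z.2) (ha.mul_prod hb)

theorem integral_sub_half_add_half {𝕜 : Type*} [RCLike 𝕜] {a b : ℝ → 𝕜}
    (ha : Integrable a) (hb : Integrable b) :
    ∫ z : ℝ × ℝ, a (z.1 - z.2 / 2) * b (z.1 + z.2 / 2) = (∫ x, a x) * ∫ x, b x := by
  have hm := measurePreserving_sub_half_add_half
  have h := integral_map (f := fun z : ℝ × ℝ => a z.1 * b z.2) hm.measurable.aemeasurable
    (by rw [hm.map_eq]; exact (ha.mul_prod hb).aestronglyMeasurable)
  rw [hm.map_eq] at h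
  rw [← integral_prod_mul a b]
  exact h.symm

/-- The series converges absolutely in `L¹`, and its sum there agrees almost everywhere with the
pointwise sum. -/
theorem integrable_tsum_of_summable_integral_norm {α ι : Type*} [Countable ι] [MeasurableSpace α]
    {μ : Measure α} {F : ι → α → ℂ} (hF : ∀ i, Integrable (F i) μ)
    (hs : Summable fun i => ∫ a, ‖F i a‖ ∂μ) : Integrable (fun a => ∑' i, F i a) μ := by
  have hn : ∀ i, ‖(hF i).toL1 (F i)‖ = ∫ a, ‖F i a‖ ∂μ := fun i => by
    rw [L1.norm_of_fun_eq_integral_norm]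
  have hs' : Summable fun i => ‖(hF i).toL1 (F i)‖ := by simpa only [hn] using hs
  have htop : ∑' i, ‖(hF i).toL1 (F i)‖ₑ ≠ ⊤ := by
    simp only [← ofReal_norm]
    exact hs'.tsum_ofReal_ne_top
  refine (L1.integrable_coeFn (∑' i, (hF i).toL1 (F i))).congr ?_
  filter_upwards [Lp.coeFn_tsum htop, ae_all_iff.2 fun i => (hF i).coeFn_toL1] with a h1 h2
  rw [h1]
  exact tsum_congr h2

/-! ### The marginals of the Wigner function -/

section Wigner

variable {ι : Type*} {ρW : MixedState ι WeightSpace}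

/-- A vector of weight zero may lie outside `D(H_W)`. This is why later proofs split on `pₖ = 0`, a
case in which the term vanishes. -/
theorem MixedState.FiniteSecondMoment.mem_domain (h : ρW.FiniteSecondMoment weightH) {k : ι}
    (hk : ρW.p k ≠ 0) : ρW.ψ k ∈ weightH.domain := h.1 k hk

theorem MixedState.FiniteSecondMoment.summable_energy (h : ρW.FiniteSecondMoment weightH) :
    Summable fun k => ρW.p k * ‖energy (ρW.ψ k)‖ := by
  refine Summable.of_nonneg_of_le (fun k => mul_nonneg (ρW.p_nonneg k) (norm_nonneg _))
    (fun k => ?_) (ρW.hasSum_p.summable.add h.2)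
  have := ρW.p_nonneg k
  nlinarith [sq_nonneg (‖energy (ρW.ψ k)‖ - 1), sq_nonneg ‖energy (ρW.ψ k)‖]

theorem MixedState.FiniteSecondMoment.integrable (h : ρW.FiniteSecondMoment weightH) {k : ι}
    (hk : ρW.p k ≠ 0) : Integrable (ρW.ψ k) :=
  (integrable_and_integral_norm_le (h.mem_domain hk) (ρW.norm_ψ k)).1

/-- The `k`-th term of the kernel in center-of-mass coordinates, with a phase. -/
def kernelTerm (ρW : MixedState ι WeightSpace) (s t : ℝ) (k : ι) (z : ℝ × ℝ) : ℂ :=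
  Complex.exp (Complex.I * z.1 * s) * (Complex.exp (Complex.I * z.2 * t) *
    ((ρW.p k : ℂ) * (ρW.ψ k (z.1 - z.2 / 2) * conj (ρW.ψ k (z.1 + z.2 / 2)))))

theorem kernelTerm_eq_zero {k : ι} (hk : ρW.p k = 0) (s t : ℝ) (z : ℝ × ℝ) :
    kernelTerm ρW s t k z = 0 := by simp [kernelTerm, hk]

/-- With `x = E - ω/2` and `y = E + ω/2`, the phase is `Es + ωt = (x + y)s/2 + (y - x)t`, so it
splits into a function of `x` and a function of `y`. -/
theorem kernelTerm_eq (s t : ℝ) (k : ι) (z : ℝ × ℝ) :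
    kernelTerm ρW s t k z = (ρW.p k : ℂ) *
      ((Complex.exp (-(Complex.I * (z.1 - z.2 / 2 : ℝ) * t)) *
        (Complex.exp (Complex.I * (z.1 - z.2 / 2 : ℝ) * (s / 2 : ℝ)) * ρW.ψ k (z.1 - z.2 / 2))) *
      conj (Complex.exp (-(Complex.I * (z.1 + z.2 / 2 : ℝ) * t)) *
        (Complex.exp (Complex.I * (z.1 + z.2 / 2 : ℝ) * (-s / 2 : ℝ)) *
          ρW.ψ k (z.1 + z.2 / 2)))) := by
  have he : Complex.exp (Complex.I * z.1 * s) * Complex.exp (Complex.I * z.2 * t) =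
      Complex.exp (-(Complex.I * (z.1 - z.2 / 2 : ℝ) * t)) *
      Complex.exp (Complex.I * (z.1 - z.2 / 2 : ℝ) * (s / 2 : ℝ)) *
      (conj (Complex.exp (-(Complex.I * (z.1 + z.2 / 2 : ℝ) * t))) *
      conj (Complex.exp (Complex.I * (z.1 + z.2 / 2 : ℝ) * (-s / 2 : ℝ)))) := by
    simp only [← Complex.exp_conj, ← Complex.exp_add]
    congr 1
    simp only [map_neg, map_mul, Complex.conj_I, Complex.conj_ofReal]
    push_cast
    ring
  rw [kernelTerm, ← mul_assoc, he]
  simp only [map_mul]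
  ring

theorem norm_exp_neg_phase (E s : ℝ) : ‖Complex.exp (-(Complex.I * E * s))‖ = 1 := by
  rw [Complex.exp_neg, norm_inv, norm_exp_phase, inv_one]

theorem integrable_phase_mul {ψ : ℝ → ℂ} (hψ : Integrable ψ) (s t : ℝ) :
    Integrable fun E : ℝ => Complex.exp (-(Complex.I * E * t)) *
      (Complex.exp (Complex.I * E * s) * ψ E) :=
  (hψ.bdd_mul (c := 1) (by fun_prop) (Eventually.of_forall fun E => (norm_exp_phase E s).le)).bdd_mul
    (c := 1) (by fun_prop) (Eventually.of_forall fun E => (norm_exp_neg_phase E t).le)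

theorem integrable_conj {ψ : ℝ → ℂ} (hψ : Integrable ψ) : Integrable fun E => conj (ψ E) :=
  Complex.conjCLE.toContinuousLinearMap.integrable_comp hψ

theorem integrable_kernelTerm (h : ρW.FiniteSecondMoment weightH) (s t : ℝ) (k : ι) :
    Integrable (kernelTerm ρW s t k) := by
  by_cases hk : ρW.p k = 0
  · simp [funext (kernelTerm_eq_zero hk s t)]
  · have hi := h.integrable hk
    rw [funext (kernelTerm_eq s t k)]
    exact (integrable_sub_half_add_half (integrable_phase_mul hi (s / 2) t)
      (integrable_conj (integrable_phase_mul hi (-s / 2) t))).const_mul _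

theorem norm_kernelTerm (s t : ℝ) (k : ι) (z : ℝ × ℝ) : ‖kernelTerm ρW s t k z‖ =
    ρW.p k * (‖ρW.ψ k (z.1 - z.2 / 2)‖ * ‖ρW.ψ k (z.1 + z.2 / 2)‖) := by
  simp [kernelTerm, norm_exp_phase, abs_of_nonneg (ρW.p_nonneg k)]

theorem integral_norm_kernelTerm_le (h : ρW.FiniteSecondMoment weightH) (s t : ℝ) (k : ι) :
    ∫ z, ‖kernelTerm ρW s t k z‖ ≤ 9 * (ρW.p k + ρW.p k * ‖energy (ρW.ψ k)‖ ^ 2) := by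
  by_cases hk : ρW.p k = 0
  · simp [kernelTerm_eq_zero hk, hk]
  · have hi := integrable_and_integral_norm_le (h.mem_domain hk) (ρW.norm_ψ k)
    have h1 : ∫ z, ‖kernelTerm ρW s t k z‖ = ρW.p k * (∫ E, ‖ρW.ψ k E‖) ^ 2 := by
      simp only [norm_kernelTerm]
      rw [integral_const_mul, integral_sub_half_add_half hi.1.norm hi.1.norm, sq]
    rw [h1]
    nlinarith [mul_le_mul_of_nonneg_left hi.2 (ρW.p_nonneg k)]

theorem summable_integral_norm_kernelTerm (h : ρW.FiniteSecondMoment weightH) (s t : ℝ) :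
    Summable fun k => ∫ z, ‖kernelTerm ρW s t k z‖ :=
  Summable.of_nonneg_of_le (fun _ => integral_nonneg fun _ => norm_nonneg _)
    (integral_norm_kernelTerm_le h s t) ((ρW.hasSum_p.summable.add h.2).mul_left 9)

theorem tsum_kernelTerm (s t : ℝ) (z : ℝ × ℝ) : ∑' k, kernelTerm ρW s t k z =
    Complex.exp (Complex.I * z.1 * s) * (Complex.exp (Complex.I * z.2 * t) *
      kernel ρW (z.1 - z.2 / 2) (z.1 + z.2 / 2)) := by
  simp only [kernelTerm, tsum_mul_left, kernel]

variable [Countable ι]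

theorem integrable_phase_mul_kernel (h : ρW.FiniteSecondMoment weightH) (s t : ℝ) :
    Integrable fun z : ℝ × ℝ => Complex.exp (Complex.I * z.1 * s) *
      (Complex.exp (Complex.I * z.2 * t) * kernel ρW (z.1 - z.2 / 2) (z.1 + z.2 / 2)) := by
  simp only [← tsum_kernelTerm]
  exact integrable_tsum_of_summable_integral_norm (integrable_kernelTerm h s t)
    (summable_integral_norm_kernelTerm h s t)

/-- The Wigner function of a state with finite second moment is integrable in the energy. -/
theorem integrable_wigner (h : ρW.FiniteSecondMoment weightH) (t : ℝ) :
    Integrable fun E : ℝ => wigner ρW E t := by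
  have h1 := (integrable_phase_mul_kernel h 0 t).integral_prod_left
  simp only [Complex.ofReal_zero, mul_zero, Complex.exp_zero, one_mul] at h1
  exact h1.const_mul _

/-- The partial Fourier transform `∫ dE e^{iEs} W(E,t)`. -/
def wignerTransform (ρW : MixedState ι WeightSpace) (s t : ℝ) : ℂ :=
  ∫ E : ℝ, Complex.exp (Complex.I * E * s) * wigner ρW E t

/-- The argument `t / (2π)` converts the kernel `e^{-2πixξ}` of `𝓕` into `e^{-ixt}`. -/
theorem fourier_modulation (ψ : WeightSpace) (s t : ℝ) :
    𝓕 (modulation s ψ : ℝ → ℂ) (t / (2 * Real.pi)) =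
      ∫ E : ℝ, Complex.exp (-(Complex.I * E * t)) * (Complex.exp (Complex.I * E * s) * ψ E) := by
  rw [Real.fourier_eq']
  refine integral_congr_ae ?_
  filter_upwards [coeFn_modulation s ψ] with E hE
  rw [hE, smul_eq_mul]
  congr 2
  simp only [RCLike.inner_apply, conj_trivial]
  push_cast
  field_simp

/-- Fubini turns the iterated integral into one over the plane. The series is then integrated
termwise, and each term factors in the coordinates `E ∓ ω/2`. -/
theorem wignerTransform_eq (h : ρW.FiniteSecondMoment weightH) (s t : ℝ) :
    wignerTransform ρW s t = (1 / (2 * Real.pi) : ℂ) * ∑' k, (ρW.p k : ℂ) *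
      (𝓕 (modulation (s / 2) (ρW.ψ k) : ℝ → ℂ) (t / (2 * Real.pi)) *
        conj (𝓕 (modulation (-s / 2) (ρW.ψ k) : ℝ → ℂ) (t / (2 * Real.pi)))) := by
  have h1 : wignerTransform ρW s t = (1 / (2 * Real.pi) : ℂ) *
      ∫ E : ℝ, ∫ ω : ℝ, Complex.exp (Complex.I * E * s) * (Complex.exp (Complex.I * ω * t) *
        kernel ρW (E - ω / 2) (E + ω / 2)) := by
    rw [wignerTransform, ← integral_const_mul]
    congr 1 with E
    rw [integral_const_mul, wigner]
    ring
  have h2 := integral_prod _ (integrable_phase_mul_kernel h s t)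
  rw [h1, ← h2]
  congr 1
  simp only [← tsum_kernelTerm]
  rw [← Measure.volume_eq_prod, ← (hasSum_integral_of_summable_integral_norm
    (integrable_kernelTerm h s t) (summable_integral_norm_kernelTerm h s t)).tsum_eq]
  refine tsum_congr fun k => ?_
  by_cases hk : ρW.p k = 0
  · simp [kernelTerm_eq_zero hk, hk]
  · have hi := h.integrable hk
    rw [integral_congr_ae (Eventually.of_forall (kernelTerm_eq s t k)), integral_const_mul,
      fourier_modulation, fourier_modulation, ← integral_conj]
    congr 1
    exact integral_sub_half_add_half (integrable_phase_mul hi (s / 2) t)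
      (integrable_conj (integrable_phase_mul hi (-s / 2) t))

end Wigner

/-! ### The Wigner transform as a differentiable curve in `L¹` -/

/-- Dominated convergence for series: `u` majorizes the difference quotients at `0`, so
differentiability of the terms is needed at that point only. -/
theorem hasDerivAt_tsum_zero {ι X : Type*} [NormedAddCommGroup X] [NormedSpace ℝ X]
    [CompleteSpace X] {g : ι → ℝ → X} {g' : ι → X} {u : ι → ℝ} (hu : Summable u)
    (hg : ∀ s, Summable fun k => g k s) (hd : ∀ k, HasDerivAt (g k) (g' k) 0)
    (hb : ∀ k s, ‖g k s - g k 0‖ ≤ |s| * u k) :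
    HasDerivAt (fun s => ∑' k, g k s) (∑' k, g' k) 0 := by
  rw [hasDerivAt_iff_tendsto_slope_zero]
  have hs : ∀ t : ℝ, t⁻¹ • (∑' k, g k (0 + t) - ∑' k, g k 0) =
      ∑' k, t⁻¹ • (g k (0 + t) - g k 0) := fun t => by
    rw [← (hg _).tsum_sub (hg 0), ((hg _).sub (hg 0)).tsum_const_smul]
  simp only [hs]
  refine tendsto_tsum_of_dominated_convergence hu (fun k => (hd k).tendsto_slope_zero)
    (eventually_mem_nhdsWithin.mono fun t ht k => ?_)
  have ht' : 0 < |t| := abs_pos.2 ht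
  rw [norm_smul, norm_inv, Real.norm_eq_abs, zero_add, inv_mul_le_iff₀ ht']
  exact hb k t

theorem integrable_exp_mul_coeFn (ω : ℝ) (g : Lp ℂ 1 (volume : Measure ℝ)) :
    Integrable fun τ : ℝ => Complex.exp (-(Complex.I * ω * (2 * Real.pi * τ : ℝ))) * g τ :=
  (L1.integrable_coeFn g).bdd_mul (c := 1) (by fun_prop)
    (Eventually.of_forall fun _ => (norm_exp_neg_phase _ _).le)

/-- The Fourier coefficient `∫ e^{-2πiωτ} g(τ) dτ`, as a continuous functional on `L¹`. -/
def fourierCoeff (ω : ℝ) : Lp ℂ 1 (volume : Measure ℝ) →L[ℂ] ℂ :=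
  LinearMap.mkContinuous
    { toFun := fun g => ∫ τ : ℝ, Complex.exp (-(Complex.I * ω * (2 * Real.pi * τ : ℝ))) * g τ
      map_add' := fun f g => by
        rw [← integral_add (integrable_exp_mul_coeFn ω f) (integrable_exp_mul_coeFn ω g)]
        refine integral_congr_ae ?_
        filter_upwards [Lp.coeFn_add f g] with τ h
        rw [h, Pi.add_apply, mul_add]
      map_smul' := fun c g => by
        rw [RingHom.id_apply, smul_eq_mul, ← integral_const_mul]
        refine integral_congr_ae ?_
        filter_upwards [Lp.coeFn_smul c g] with τ h
        rw [h, Pi.smul_apply, smul_eq_mul, mul_left_comm] }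
    1 fun g => by
      rw [one_mul, L1.norm_eq_integral_norm]
      refine (norm_integral_le_integral_norm _).trans (le_of_eq ?_)
      simp only [norm_mul, norm_exp_neg_phase, one_mul]

theorem fourierCoeff_apply (ω : ℝ) (g : Lp ℂ 1 (volume : Measure ℝ)) : fourierCoeff ω g =
    ∫ τ : ℝ, Complex.exp (-(Complex.I * ω * (2 * Real.pi * τ : ℝ))) * g τ := rfl

theorem ae_comp_two_pi_mul {p : ℝ → Prop} (h : ∀ᵐ t, p t) : ∀ᵐ τ, p (2 * Real.pi * τ) := by
  have hq : Measure.QuasiMeasurePreserving (fun τ : ℝ => 2 * Real.pi * τ) volume volume :=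
    ⟨by fun_prop, by
      rw [Real.map_volume_mul_left Real.two_pi_pos.ne']
      exact Measure.smul_absolutelyContinuous⟩
  exact hq.ae h

theorem integrable_of_coeFn_ae_eq {g : ℝ → ℂ} {G : Lp ℂ 1 (volume : Measure ℝ)}
    (h : G =ᵐ[volume] fun τ => (2 * Real.pi : ℂ) * g (2 * Real.pi * τ)) : Integrable g := by
  rw [← integrable_comp_mul_left_iff _ Real.two_pi_pos.ne']
  refine (((L1.integrable_coeFn G).congr h).const_mul (2 * Real.pi : ℂ)⁻¹).congr
    (Eventually.of_forall fun τ => ?_)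
  have : (2 * Real.pi : ℂ) ≠ 0 := by exact_mod_cast Real.two_pi_pos.ne'
  simp only
  rw [inv_mul_cancel_left₀ this]

theorem integral_exp_mul_of_coeFn_ae_eq {g : ℝ → ℂ} {G : Lp ℂ 1 (volume : Measure ℝ)} (ω : ℝ)
    (h : G =ᵐ[volume] fun τ => (2 * Real.pi : ℂ) * g (2 * Real.pi * τ)) :
    ∫ t : ℝ, Complex.exp (-(Complex.I * ω * t)) * g t = fourierCoeff ω G := by
  have h1 := Measure.integral_comp_mul_left
    (fun t : ℝ => Complex.exp (-(Complex.I * ω * t)) * g t) (2 * Real.pi)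
  rw [abs_of_pos (inv_pos.2 Real.two_pi_pos), eq_inv_smul_iff₀ Real.two_pi_pos.ne'] at h1
  rw [fourierCoeff_apply, ← h1, Complex.real_smul, ← integral_const_mul]
  refine integral_congr_ae ?_
  filter_upwards [h] with τ hτ
  rw [hτ]
  push_cast
  ring

/-- The phase `e^{-2πiωτ}` is absorbed into `conj (𝓕 h)`, where it amounts to translating `h` by
`-ω`; Parseval then removes both transforms. -/
theorem fourierCoeff_fourierPairing (ω : ℝ) {f h : WeightSpace} (hf : Integrable f)
    (hh : Integrable h) :
    fourierCoeff ω (fourierPairing f h) = inner ℂ (displacement (-ω) h) f := by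
  have hd : Integrable (displacement (-ω) h) := by
    refine (integrable_congr (coeFn_displacement _ _)).2 ?_
    simpa using hh.comp_add_right ω
  rw [← Lp.inner_fourier_eq, L2.inner_def, fourierCoeff_apply]
  refine integral_congr_ae ?_
  filter_upwards [coeFn_fourierPairing_of_integrable hf hh, coeFn_fourier_ae_eq f hf,
    coeFn_fourier_ae_eq _ hd] with τ h1 h2 h3
  have h4 : 𝓕 (displacement (-ω) h : ℝ → ℂ) τ =
      Complex.exp (Complex.I * ω * (2 * Real.pi * τ : ℝ)) * 𝓕 (h : ℝ → ℂ) τ := by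
    rw [Real.fourier_eq', Real.fourier_eq', ← integral_const_mul,
      ← integral_add_right_eq_self _ (-ω)]
    have hq := (measurePreserving_add_right (volume : Measure ℝ) (-ω)).quasiMeasurePreserving
    refine integral_congr_ae ?_
    filter_upwards [hq.ae_eq_comp (coeFn_displacement (-ω) h)] with E hE
    simp only [Function.comp_apply] at hE
    rw [hE, smul_eq_mul, smul_eq_mul, ← mul_assoc, ← Complex.exp_add]
    congr 2
    · simp only [RCLike.inner_apply, conj_trivial]
      push_cast
      ring
    · ring
  rw [h1, h2, h3, h4, RCLike.inner_apply, map_mul, ← Complex.exp_conj]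
  simp only [map_mul, Complex.conj_I, Complex.conj_ofReal]
  ring_nf

theorem inner_modulation (s : ℝ) (f g : WeightSpace) :
    inner ℂ (modulation (-s / 2) f) (modulation (s / 2) g) = inner ℂ f (modulation s g) := by
  rw [L2.inner_def, L2.inner_def]
  refine integral_congr_ae ?_
  filter_upwards [coeFn_modulation (-s / 2) f, coeFn_modulation (s / 2) g, coeFn_modulation s g]
    with E h1 h2 h3
  rw [h1, h2, h3, RCLike.inner_apply, RCLike.inner_apply, map_mul, ← Complex.exp_conj,
    show Complex.I * E * s = Complex.I * E * (s / 2 : ℝ) + conj (Complex.I * E * (-s / 2 : ℝ)) by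
      simp only [map_mul, Complex.conj_I, Complex.conj_ofReal]; push_cast; ring,
    Complex.exp_add]
  ring

section Wigner

variable {ι : Type*} {ρW : MixedState ι WeightSpace}

/-- The contribution of the `k`-th pure state to `wignerCurve`. -/
def curveTerm (ρW : MixedState ι WeightSpace) (k : ι) (s : ℝ) : Lp ℂ 1 (volume : Measure ℝ) :=
  ρW.p k • fourierPairing (modulation (s / 2) (ρW.ψ k)) (modulation (-s / 2) (ρW.ψ k))

/-- The curve `s ↦ (τ ↦ 2π ∫ dE e^{iEs} W(E, 2πτ))` in `L¹`. -/
def wignerCurve (ρW : MixedState ι WeightSpace) (s : ℝ) : Lp ℂ 1 (volume : Measure ℝ) :=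
  ∑' k, curveTerm ρW k s

theorem norm_curveTerm_le (k : ι) (s : ℝ) : ‖curveTerm ρW k s‖ ≤ ρW.p k := by
  rw [curveTerm, norm_smul, Real.norm_of_nonneg (ρW.p_nonneg k)]
  refine mul_le_of_le_one_right (ρW.p_nonneg k) ((norm_fourierPairing_le _ _).trans ?_)
  rw [norm_modulation, norm_modulation, ρW.norm_ψ, one_mul]

theorem summable_norm_curveTerm (s : ℝ) : Summable fun k => ‖curveTerm ρW k s‖ :=
  Summable.of_nonneg_of_le (fun _ => norm_nonneg _) (norm_curveTerm_le · s)
    ρW.hasSum_p.summable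

/-- This ties the abstract `L¹` sum to the actual Wigner integral. The exceptional null set depends
on `s`. -/
theorem coeFn_wignerCurve [Countable ι] (h : ρW.FiniteSecondMoment weightH) (s : ℝ) :
    wignerCurve ρW s =ᵐ[volume]
      fun τ => (2 * Real.pi : ℂ) * wignerTransform ρW s (2 * Real.pi * τ) := by
  have htop : ∑' k, ‖curveTerm ρW k s‖ₑ ≠ ⊤ := by
    simp only [← ofReal_norm]
    exact (summable_norm_curveTerm s).tsum_ofReal_ne_top
  have hterm : ∀ k, curveTerm ρW k s =ᵐ[volume] fun τ => (ρW.p k : ℂ) *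
      (𝓕 (modulation (s / 2) (ρW.ψ k) : ℝ → ℂ) τ *
        conj (𝓕 (modulation (-s / 2) (ρW.ψ k) : ℝ → ℂ) τ)) := fun k => by
    by_cases hk : ρW.p k = 0
    · simp only [curveTerm, hk, zero_smul, Complex.ofReal_zero, zero_mul]
      exact Lp.coeFn_zero _ _ _
    · have hi := h.integrable hk
      filter_upwards [Lp.coeFn_smul (ρW.p k) (fourierPairing (modulation (s / 2) (ρW.ψ k))
        (modulation (-s / 2) (ρW.ψ k))), coeFn_fourierPairing_of_integrable
        (integrable_modulation hi (s / 2)) (integrable_modulation hi (-s / 2))] with τ h1 h2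
      rw [curveTerm, h1, Pi.smul_apply, h2, Complex.real_smul]
  filter_upwards [Lp.coeFn_tsum htop, ae_all_iff.2 hterm] with τ h1 h2
  have hpi : (2 * Real.pi * τ) / (2 * Real.pi) = τ := by field_simp
  rw [wignerCurve, h1, wignerTransform_eq h, hpi, tsum_congr h2, ← mul_assoc,
    mul_one_div_cancel (by exact_mod_cast Real.two_pi_pos.ne'), one_mul]

theorem integrable_wignerTransform [Countable ι] (h : ρW.FiniteSecondMoment weightH) (s : ℝ) :
    Integrable (wignerTransform ρW s) :=
  integrable_of_coeFn_ae_eq (coeFn_wignerCurve h s)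

theorem integral_exp_mul_wignerTransform [Countable ι] (h : ρW.FiniteSecondMoment weightH)
    (ω s : ℝ) : ∫ t : ℝ, Complex.exp (-(Complex.I * ω * t)) * wignerTransform ρW s t =
      fourierCoeff ω (wignerCurve ρW s) :=
  integral_exp_mul_of_coeFn_ae_eq ω (coeFn_wignerCurve h s)

/-- The contribution of the `k`-th pure state to the derivative of `wignerCurve` at `0`. -/
def curveTermDeriv (ρW : MixedState ι WeightSpace) (k : ι) : Lp ℂ 1 (volume : Measure ℝ) :=
  ρW.p k • (fourierPairing ((1 / 2 : ℝ) • Complex.I • energy (ρW.ψ k)) (ρW.ψ k) +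
    fourierPairing (ρW.ψ k) ((-1 / 2 : ℝ) • Complex.I • energy (ρW.ψ k)))

/-- The derivative of `wignerCurve` at `0`. -/
def wignerCurveDeriv (ρW : MixedState ι WeightSpace) : Lp ℂ 1 (volume : Measure ℝ) :=
  ∑' k, curveTermDeriv ρW k

theorem hasDerivAt_modulation_mul {ψ : WeightSpace} (h : ψ ∈ weightH.domain) (c : ℝ) :
    HasDerivAt (fun s => modulation (s * c) ψ) (c • Complex.I • energy ψ) 0 := by
  have h1 : HasDerivAt (fun s : ℝ => s * c) c 0 := by
    simpa using (hasDerivAt_id (0 : ℝ)).mul_const c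
  exact HasDerivAt.scomp_of_eq (0 : ℝ) (hasDerivAt_modulation_zero h) h1 (by simp)

theorem hasDerivAt_modulation_half {ψ : WeightSpace} (h : ψ ∈ weightH.domain) :
    HasDerivAt (fun s => modulation (s / 2) ψ) ((1 / 2 : ℝ) • Complex.I • energy ψ) 0 := by
  convert hasDerivAt_modulation_mul h (1 / 2) using 3
  ring

theorem hasDerivAt_modulation_neg_half {ψ : WeightSpace} (h : ψ ∈ weightH.domain) :
    HasDerivAt (fun s => modulation (-s / 2) ψ) ((-1 / 2 : ℝ) • Complex.I • energy ψ) 0 := by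
  convert hasDerivAt_modulation_mul h (-1 / 2) using 3
  ring

theorem hasDerivAt_curveTerm (h : ρW.FiniteSecondMoment weightH) (k : ι) :
    HasDerivAt (curveTerm ρW k) (curveTermDeriv ρW k) 0 := by
  by_cases hk : ρW.p k = 0
  · have : curveTerm ρW k = fun _ => 0 := by funext s; simp [curveTerm, hk]
    rw [this]
    simpa [curveTermDeriv, hk] using hasDerivAt_const (0 : ℝ) (0 : Lp ℂ 1 (volume : Measure ℝ))
  · have hd := h.mem_domain hk
    have h1 := (fourierPairing.hasFDerivAt (x := modulation (0 / 2) (ρW.ψ k))).comp_hasDerivAt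
      (0 : ℝ) (hasDerivAt_modulation_half hd)
    have h2 := h1.clm_apply (hasDerivAt_modulation_neg_half hd)
    have h3 := h2.const_smul (ρW.p k)
    simp only [Function.comp_apply, zero_div, neg_zero, modulation_zero] at h3
    exact h3

/-- By bilinearity the increment splits into a change of each factor, and each change costs at most
`|s|/2 · ‖H_W ψ‖`. -/
theorem norm_curveTerm_sub_le (h : ρW.FiniteSecondMoment weightH) (k : ι) (s : ℝ) :
    ‖curveTerm ρW k s - curveTerm ρW k 0‖ ≤ |s| * (ρW.p k * ‖energy (ρW.ψ k)‖) := by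
  by_cases hk : ρW.p k = 0
  · simp [curveTerm, hk]
  · have hd := h.mem_domain hk
    simp only [curveTerm, zero_div, neg_zero, modulation_zero]
    set ψ := ρW.ψ k with hψ
    have hψ1 : ‖ψ‖ = 1 := ρW.norm_ψ k
    have e : fourierPairing (modulation (s / 2) ψ) (modulation (-s / 2) ψ) - fourierPairing ψ ψ =
        fourierPairing (modulation (s / 2) ψ - ψ) (modulation (-s / 2) ψ) +
        fourierPairing ψ (modulation (-s / 2) ψ - ψ) := by
      simp only [map_sub, sub_apply]
      abel
    have h1 := (norm_fourierPairing_le (modulation (s / 2) ψ - ψ) (modulation (-s / 2) ψ))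
    have h2 := (norm_fourierPairing_le ψ (modulation (-s / 2) ψ - ψ))
    rw [norm_modulation, hψ1, mul_one] at h1
    rw [hψ1, one_mul] at h2
    have h3 := norm_modulation_sub_le hd (s / 2)
    have h4 := norm_modulation_sub_le hd (-s / 2)
    rw [abs_div, abs_two] at h3 h4
    rw [abs_neg] at h4
    rw [← smul_sub, e, norm_smul, Real.norm_of_nonneg (ρW.p_nonneg k)]
    calc _ ≤ ρW.p k * (|s| / 2 * ‖energy ψ‖ + |s| / 2 * ‖energy ψ‖) := by
          gcongr
          · exact ρW.p_nonneg k
          · exact (norm_add_le _ _).trans (add_le_add (h1.trans h3) (h2.trans h4))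
      _ = _ := by ring

theorem hasDerivAt_wignerCurve (h : ρW.FiniteSecondMoment weightH) :
    HasDerivAt (wignerCurve ρW) (wignerCurveDeriv ρW) 0 :=
  hasDerivAt_tsum_zero h.summable_energy (fun s => (summable_norm_curveTerm s).of_norm)
    (hasDerivAt_curveTerm h) (norm_curveTerm_sub_le h)

theorem summable_curveTermDeriv (h : ρW.FiniteSecondMoment weightH) :
    Summable (curveTermDeriv ρW) := by
  refine Summable.of_norm_bounded h.summable_energy fun k => ?_
  rw [curveTermDeriv, norm_smul, Real.norm_of_nonneg (ρW.p_nonneg k)]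
  refine mul_le_mul_of_nonneg_left ((norm_add_le _ _).trans ?_) (ρW.p_nonneg k)
  refine (add_le_add (norm_fourierPairing_le _ _) (norm_fourierPairing_le _ _)).trans ?_
  simp only [norm_smul, ρW.norm_ψ, Complex.norm_I, one_mul, mul_one]
  norm_num
  linarith [norm_nonneg (energy (ρW.ψ k))]

/-- The overlap `∑ₖ pₖ ⟨Γ_{-ω} ψₖ, ψₖ⟩`. -/
def overlap (ρW : MixedState ι WeightSpace) (ω : ℝ) : ℂ :=
  ∑' k, (ρW.p k : ℂ) * inner ℂ (displacement (-ω) (ρW.ψ k)) (ρW.ψ k)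

/-- The energy-weighted overlap `½ ∑ₖ pₖ (⟨Γ_{-ω} ψₖ, H_W ψₖ⟩ + ⟨Γ_{-ω} H_W ψₖ, ψₖ⟩)`. -/
def energyOverlap (ρW : MixedState ι WeightSpace) (ω : ℝ) : ℂ :=
  ∑' k, (ρW.p k : ℂ) * ((1 / 2 : ℂ) * (inner ℂ (displacement (-ω) (energy (ρW.ψ k))) (ρW.ψ k) +
    inner ℂ (displacement (-ω) (ρW.ψ k)) (energy (ρW.ψ k))))

theorem fourierCoeff_curveTerm (h : ρW.FiniteSecondMoment weightH) (ω s : ℝ) (k : ι) :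
    fourierCoeff ω (curveTerm ρW k s) = (ρW.p k : ℂ) *
      inner ℂ (displacement (-ω) (modulation (-s / 2) (ρW.ψ k))) (modulation (s / 2) (ρW.ψ k)) := by
  by_cases hk : ρW.p k = 0
  · simp [curveTerm, hk]
  · have hi := h.integrable hk
    rw [curveTerm, map_real_smul (fourierCoeff ω) (fourierCoeff ω).continuous,
      fourierCoeff_fourierPairing ω (integrable_modulation hi _) (integrable_modulation hi _),
      Complex.real_smul]

theorem fourierCoeff_wignerCurve (h : ρW.FiniteSecondMoment weightH) (ω s : ℝ) :
    fourierCoeff ω (wignerCurve ρW s) = ∑' k, (ρW.p k : ℂ) *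
      inner ℂ (displacement (-ω) (modulation (-s / 2) (ρW.ψ k))) (modulation (s / 2) (ρW.ψ k)) := by
  rw [wignerCurve, (fourierCoeff ω).map_tsum (summable_norm_curveTerm s).of_norm]
  exact tsum_congr (fourierCoeff_curveTerm h ω s)

theorem fourierCoeff_wignerCurve_zero (h : ρW.FiniteSecondMoment weightH) (ω : ℝ) :
    fourierCoeff ω (wignerCurve ρW 0) = overlap ρW ω := by
  simp [fourierCoeff_wignerCurve h, overlap, modulation_zero]

theorem overlap_zero : overlap ρW 0 = 1 := by
  have h := Complex.hasSum_ofReal.2 ρW.hasSum_p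
  simp only [overlap, neg_zero, displacement_zero, inner_self_eq_norm_sq_to_K, ρW.norm_ψ]
  simpa using h.tsum_eq

/-- Parseval in the form `fourierCoeff_fourierPairing` asks for integrable functions, and `H_W ψₖ`
need not be integrable. The formula for `fourierCoeff ω (curveTerm ρW k s)` is differentiated on
both sides instead, and uniqueness of the derivative concludes. -/
theorem fourierCoeff_curveTermDeriv (h : ρW.FiniteSecondMoment weightH) (ω : ℝ) (k : ι) :
    fourierCoeff ω (curveTermDeriv ρW k) = Complex.I * ((ρW.p k : ℂ) * ((1 / 2 : ℂ) *
      (inner ℂ (displacement (-ω) (energy (ρW.ψ k))) (ρW.ψ k) +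
        inner ℂ (displacement (-ω) (ρW.ψ k)) (energy (ρW.ψ k))))) := by
  by_cases hk : ρW.p k = 0
  · simp [curveTermDeriv, hk]
  · have hd := h.mem_domain hk
    have h1 : HasDerivAt (fun s => fourierCoeff ω (curveTerm ρW k s))
        (fourierCoeff ω (curveTermDeriv ρW k)) 0 :=
      ((fourierCoeff ω).restrictScalars ℝ).hasFDerivAt.comp_hasDerivAt (0 : ℝ)
        (hasDerivAt_curveTerm h k)
    simp only [fourierCoeff_curveTerm h] at h1
    have h2 : HasDerivAt (fun s => displacement (-ω) (modulation (-s / 2) (ρW.ψ k)))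
        (displacement (-ω) ((-1 / 2 : ℝ) • Complex.I • energy (ρW.ψ k))) 0 :=
      (((displacement (-ω) : WeightSpace →L[ℂ] WeightSpace)).restrictScalars
        ℝ).hasFDerivAt.comp_hasDerivAt (0 : ℝ) (hasDerivAt_modulation_neg_half hd)
    have h3 := (h2.inner ℂ (hasDerivAt_modulation_half hd)).const_mul (ρW.p k : ℂ)
    rw [h1.unique h3]
    simp only [zero_div, neg_zero, modulation_zero]
    rw [← algebraMap_smul ℂ (1 / 2 : ℝ), ← algebraMap_smul ℂ (-1 / 2 : ℝ), map_smul, map_smul, inner_smul_left,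
      inner_smul_left, inner_smul_right, inner_smul_right, Complex.coe_algebraMap,
      Complex.conj_ofReal, Complex.conj_I]
    push_cast
    ring

theorem fourierCoeff_wignerCurveDeriv (h : ρW.FiniteSecondMoment weightH) (ω : ℝ) :
    fourierCoeff ω (wignerCurveDeriv ρW) = Complex.I * energyOverlap ρW ω := by
  rw [wignerCurveDeriv, (fourierCoeff ω).map_tsum (summable_curveTermDeriv h), energyOverlap,
    ← tsum_mul_left]
  exact tsum_congr (fourierCoeff_curveTermDeriv h ω)

theorem hasDerivAt_fourierCoeff_wignerCurve (h : ρW.FiniteSecondMoment weightH) (ω : ℝ) :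
    HasDerivAt (fun s => fourierCoeff ω (wignerCurve ρW s))
      (Complex.I * energyOverlap ρW ω) 0 := by
  rw [← fourierCoeff_wignerCurveDeriv h]
  exact ((fourierCoeff ω).restrictScalars ℝ).hasFDerivAt.comp_hasDerivAt (0 : ℝ)
    (hasDerivAt_wignerCurve h)

/-- At `ω = 0` the two half modulations recombine into `e^{isH_W}`, so the denominator of `ξ_S` is
itself a Fourier coefficient of the curve. -/
theorem expect_phase (h : ρW.FiniteSecondMoment weightH) (s : ℝ) :
    ρW.expect (mulOp fun E => Complex.exp (Complex.I * E * s)) =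
      fourierCoeff 0 (wignerCurve ρW s) := by
  rw [fourierCoeff_wignerCurve h, MixedState.expect]
  refine tsum_congr fun k => ?_
  rw [app_mulOp_phase, neg_zero, displacement_zero, inner_modulation]

theorem hasDerivAt_wignerTransform [Countable ι] (h : ρW.FiniteSecondMoment weightH) {t : ℝ}
    (hE : Integrable fun E : ℝ => (E : ℂ) * wigner ρW E t) :
    HasDerivAt (fun s => wignerTransform ρW s t)
      (Complex.I * ∫ E : ℝ, (E : ℂ) * wigner ρW E t) 0 := by
  have hW := integrable_wigner h t
  have hexp : ∀ s : ℝ, AEStronglyMeasurable (fun E : ℝ => Complex.exp (Complex.I * E * s))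
    volume := fun s => by fun_prop
  have key := (hasDerivAt_integral_of_dominated_loc_of_deriv_le (x₀ := (0 : ℝ))
    (F := fun (s : ℝ) (E : ℝ) => Complex.exp (Complex.I * E * s) * wigner ρW E t)
    (F' := fun (s : ℝ) (E : ℝ) =>
      Complex.exp (Complex.I * E * s) * (Complex.I * ((E : ℂ) * wigner ρW E t)))
    (bound := fun E : ℝ => ‖(E : ℂ) * wigner ρW E t‖) univ_mem
    (Eventually.of_forall fun s => (hexp s).mul hW.aestronglyMeasurable)
    (by simpa using hW) ((hexp 0).mul (hE.const_mul Complex.I).aestronglyMeasurable)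
    (Eventually.of_forall fun E s _ => by
      rw [norm_mul, norm_exp_phase, one_mul, norm_mul, Complex.norm_I, one_mul])
    hE.norm (Eventually.of_forall fun E s _ => ?_)).2
  · simp only [Complex.ofReal_zero, mul_zero, Complex.exp_zero, one_mul] at key
    rw [integral_const_mul] at key
    exact key
  · have h1 : HasDerivAt (fun s : ℝ => Complex.I * E * (s : ℂ)) (Complex.I * E) s := by
      simpa using (Complex.ofRealCLM.hasDerivAt (x := s)).const_mul (Complex.I * E)
    have h2 := h1.cexp.mul_const (wigner ρW E t)
    rwa [mul_assoc (Complex.exp _), mul_assoc Complex.I (E : ℂ) (wigner ρW E t)] at h2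

/-- For almost every `t`, the first moment `∫ E W(E,t) dE` is given by `wignerCurveDeriv` as soon
as it converges. -/
theorem wignerCurveDeriv_ae_eq [Countable ι] (h : ρW.FiniteSecondMoment weightH)
    (hE : ∀ᵐ t : ℝ, Integrable fun E : ℝ => (E : ℂ) * wigner ρW E t) :
    wignerCurveDeriv ρW =ᵐ[volume] fun τ => (2 * Real.pi : ℂ) *
      (Complex.I * ∫ E : ℝ, (E : ℂ) * wigner ρW E (2 * Real.pi * τ)) := by
  -- A sequence of increments is used so that the null sets of `coeFn_wignerCurve`, one for each
  -- `s`, have a null union.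
  have hs : Tendsto (fun n : ℕ => 1 / ((n : ℝ) + 1)) atTop (𝓝[≠] 0) :=
    tendsto_nhdsWithin_iff.2 ⟨tendsto_one_div_add_atTop_nhds_zero_nat,
      Eventually.of_forall fun n => by
        simp only [Set.mem_compl_iff, Set.mem_singleton_iff]; positivity⟩
  have hlim := (hasDerivAt_wignerCurve h).tendsto_slope_zero.comp hs
  -- Convergence of the quotients in `L¹` gives almost everywhere convergence along a subsequence,
  -- to be compared with the pointwise derivative.
  obtain ⟨ns, hns, hae⟩ := (tendstoInMeasure_of_tendsto_Lp hlim).exists_seq_tendsto_ae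
  have hc : ∀ᵐ τ : ℝ, ∀ n : ℕ, (((1 / ((n : ℝ) + 1))⁻¹ • (wignerCurve ρW (0 + 1 / ((n : ℝ) + 1))
      - wignerCurve ρW 0) : Lp ℂ 1 (volume : Measure ℝ)) : ℝ → ℂ) τ =
      (2 * Real.pi : ℂ) * ((1 / ((n : ℝ) + 1))⁻¹ •
        (wignerTransform ρW (0 + 1 / ((n : ℝ) + 1)) (2 * Real.pi * τ)
          - wignerTransform ρW 0 (2 * Real.pi * τ))) := by
    refine ae_all_iff.2 fun n => ?_
    set s := 1 / ((n : ℝ) + 1)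
    filter_upwards [coeFn_wignerCurve h (0 + s), coeFn_wignerCurve h 0,
      Lp.coeFn_sub (wignerCurve ρW (0 + s)) (wignerCurve ρW 0),
      Lp.coeFn_smul s⁻¹ (wignerCurve ρW (0 + s) - wignerCurve ρW 0)] with τ h1 h2 h3 h4
    rw [h4, Pi.smul_apply, h3, Pi.sub_apply, h1, h2, ← mul_sub, mul_smul_comm]
  filter_upwards [hae, ae_comp_two_pi_mul hE, hc] with τ h1 h2 h3
  have hd := (hasDerivAt_wignerTransform h h2).tendsto_slope_zero.comp
    (hs.comp hns.tendsto_atTop)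
  refine tendsto_nhds_unique h1 ((hd.const_mul (2 * Real.pi : ℂ)).congr fun n => ?_)
  exact (h3 (ns n)).symm

end Wigner

/-! ### The weight's Hamiltonian under displacements -/

/-- `E ψ(E - a) = (E - a) ψ(E - a) + a ψ(E - a)`; all later commutation relations rest on this
identity. -/
theorem displacement_mem_domain {ψ : WeightSpace} (h : ψ ∈ weightH.domain) (a : ℝ) :
    displacement a ψ ∈ weightH.domain ∧
      energy (displacement a ψ) = displacement a (energy ψ) + (a : ℂ) • displacement a ψ := by
  have hq := (measurePreserving_sub_right (volume : Measure ℝ) a).quasiMeasurePreserving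
  have he : (fun E : ℝ => (E : ℂ) * displacement a ψ E) =ᵐ[volume]
      (displacement a (energy ψ) + (a : ℂ) • displacement a ψ : WeightSpace) := by
    filter_upwards [coeFn_displacement a ψ, coeFn_displacement a (energy ψ),
      hq.ae_eq_comp (coeFn_energy h), Lp.coeFn_add (displacement a (energy ψ))
      ((a : ℂ) • displacement a ψ), Lp.coeFn_smul (a : ℂ) (displacement a ψ)] with E h1 h2 h3 h4 h5
    simp only [Function.comp_apply] at h3
    rw [h4, Pi.add_apply, h5, Pi.smul_apply, h2, h3, h1, smul_eq_mul]
    push_cast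
    ring
  have hd : displacement a ψ ∈ weightH.domain := (memLp_congr_ae he).2 (Lp.memLp _)
  exact ⟨hd, Lp.ext ((coeFn_energy hd).trans he)⟩

theorem inner_energy_comm {φ ψ : WeightSpace} (hφ : φ ∈ weightH.domain)
    (hψ : ψ ∈ weightH.domain) : inner ℂ (energy φ) ψ = inner ℂ φ (energy ψ) := by
  rw [L2.inner_def, L2.inner_def]
  refine integral_congr_ae ?_
  filter_upwards [coeFn_energy hφ, coeFn_energy hψ] with E h1 h2
  rw [h1, h2, RCLike.inner_apply, RCLike.inner_apply, map_mul, Complex.conj_ofReal]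
  ring

/-! ### Operators on the composite space and their commutation with `H_W` -/

section Operators

theorem mem_onWeight_domain {n : Type*} {A : WeightSpace →ₗ.[ℂ] WeightSpace} {Φ : TotalSpace n} :
    Φ ∈ (onWeight A : TotalSpace n →ₗ.[ℂ] TotalSpace n).domain ↔ ∀ i, Φ i ∈ A.domain := Iff.rfl

variable {n : Type*} [Fintype n]

theorem onSystem_apply (M : Matrix n n ℂ) (Φ : TotalSpace n) (i : n) :
    onSystem M Φ i = ∑ j, M i j • Φ j := by
  simp [onSystem]

theorem onSystem_sub (M N : Matrix n n ℂ) (Φ : TotalSpace n) :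
    onSystem (M - N) Φ = onSystem M Φ - onSystem N Φ := by
  ext1 i
  simp [onSystem_apply, sub_smul, Finset.sum_sub_distrib]

theorem onSystem_mul (M N : Matrix n n ℂ) (Φ : TotalSpace n) :
    onSystem (M * N) Φ = onSystem M (onSystem N Φ) := by
  ext1 i
  simp only [onSystem_apply, Matrix.mul_apply, Finset.sum_smul, Finset.smul_sum, smul_smul]
  exact Finset.sum_comm

theorem inner_onSystem_right (M : Matrix n n ℂ) (Φ Ψ : TotalSpace n) :
    inner ℂ Φ (onSystem M Ψ) = ∑ i, ∑ j, M i j * inner ℂ (Φ i) (Ψ j) := by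
  simp [PiLp.inner_apply, onSystem_apply, inner_sum, inner_smul_right]

theorem inner_onSystem_left (M : Matrix n n ℂ) (Φ Ψ : TotalSpace n) :
    inner ℂ (onSystem M Φ) Ψ = inner ℂ Φ (onSystem M.conjTranspose Ψ) := by
  rw [inner_onSystem_right, PiLp.inner_apply, Finset.sum_comm]
  simp [onSystem_apply, sum_inner, inner_smul_left]

/-- The energy `H_W Φ` of the weight in the composite system. -/
abbrev totalEnergy (Φ : TotalSpace n) : TotalSpace n := app (onWeight weightH) Φ

theorem totalEnergy_apply {Φ : TotalSpace n} (h : ∀ i, Φ i ∈ weightH.domain) (i : n) :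
    totalEnergy Φ i = energy (Φ i) := by
  rw [totalEnergy, app_of_mem (mem_onWeight_domain.2 h), energy, app_of_mem (h i)]
  rfl

theorem energy_sum {α : Type*} (s : Finset α) (c : α → ℂ) {f : α → WeightSpace}
    (h : ∀ j, f j ∈ weightH.domain) : ∑ j ∈ s, c j • f j ∈ weightH.domain ∧
      energy (∑ j ∈ s, c j • f j) = ∑ j ∈ s, c j • energy (f j) := by
  have hm : ∑ j ∈ s, c j • f j ∈ weightH.domain :=
    Submodule.sum_mem _ fun j _ => Submodule.smul_mem _ _ (h j)
  refine ⟨hm, ?_⟩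
  rw [energy, app_of_mem hm]
  have : (⟨∑ j ∈ s, c j • f j, hm⟩ : weightH.domain) = ∑ j ∈ s, c j • ⟨f j, h j⟩ := by
    ext1; simp
  rw [this]
  refine (map_sum weightH.toFun _ _).trans (Finset.sum_congr rfl fun j _ => ?_)
  rw [map_smul, energy, app_of_mem (h j)]
  rfl

theorem totalEnergy_onSystem {Φ : TotalSpace n} (h : ∀ i, Φ i ∈ weightH.domain)
    (M : Matrix n n ℂ) : (∀ i, onSystem M Φ i ∈ weightH.domain) ∧
      totalEnergy (onSystem M Φ) = onSystem M (totalEnergy Φ) := by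
  have hm : ∀ i, onSystem M Φ i ∈ weightH.domain := fun i => by
    rw [onSystem_apply]
    exact (energy_sum _ _ h).1
  refine ⟨hm, ?_⟩
  ext1 i
  rw [totalEnergy_apply hm, onSystem_apply, onSystem_apply, (energy_sum _ _ h).2]
  simp only [totalEnergy_apply h]

theorem totalEnergy_tensor (v : EuclideanSpace ℂ n) {ψ : WeightSpace}
    (h : ψ ∈ weightH.domain) : (∀ i, tensor v ψ i ∈ weightH.domain) ∧
      totalEnergy (tensor v ψ) = tensor v (energy ψ) := by
  have hm : ∀ i, tensor v ψ i ∈ weightH.domain := fun i => Submodule.smul_mem _ _ h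
  refine ⟨hm, ?_⟩
  ext1 i
  have := (energy_sum {i} v (f := fun _ => ψ) fun _ => h).2
  simp only [Finset.sum_singleton] at this
  rw [totalEnergy_apply hm]
  exact this

theorem controlS_apply (ε : n → ℝ) (Φ : TotalSpace n) (i : n) :
    controlS ε Φ i = displacement (ε i) (Φ i) := rfl

theorem controlS_symm_eq (ε : n → ℝ) (Φ : TotalSpace n) :
    (controlS ε).symm Φ = controlS (-ε) Φ := by
  ext1 i
  exact displacement_symm _ _

theorem totalU_apply (ε : n → ℝ) (V : Matrix n n ℂ) (Φ : TotalSpace n) :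
    totalU ε V Φ = (controlS ε).symm (onSystem V (controlS ε Φ)) := rfl

theorem adjoint_totalU (ε : n → ℝ) (V : Matrix n n ℂ) :
    ContinuousLinearMap.adjoint (totalU ε V) = totalU ε V.conjTranspose := by
  refine ((ContinuousLinearMap.eq_adjoint_iff _ _).2 fun x y => ?_).symm
  rw [totalU_apply, totalU_apply, ← (controlS ε).inner_map_map, LinearIsometryEquiv.apply_symm_apply,
    inner_onSystem_left, Matrix.conjTranspose_conjTranspose,
    ← (controlS ε).inner_map_map x, LinearIsometryEquiv.apply_symm_apply]

variable [DecidableEq n]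

theorem onSystem_one (Φ : TotalSpace n) : onSystem 1 Φ = Φ := by
  ext1 i
  simp [onSystem_apply, Matrix.one_apply]

theorem onSystem_systemH_apply (ε : n → ℝ) (Φ : TotalSpace n) (i : n) :
    onSystem (systemH ε) Φ i = (ε i : ℂ) • Φ i := by
  simp [onSystem_apply, systemH, Matrix.diagonal_apply]

theorem controlS_onSystem_systemH (ε ε' : n → ℝ) (Φ : TotalSpace n) :
    controlS ε' (onSystem (systemH ε) Φ) = onSystem (systemH ε) (controlS ε' Φ) := by
  ext1 i
  rw [controlS_apply, onSystem_systemH_apply, onSystem_systemH_apply, map_smul, controlS_apply]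

theorem totalEnergy_controlS {Φ : TotalSpace n} (h : ∀ i, Φ i ∈ weightH.domain) (ε : n → ℝ) :
    (∀ i, controlS ε Φ i ∈ weightH.domain) ∧ totalEnergy (controlS ε Φ) =
      controlS ε (totalEnergy Φ) + onSystem (systemH ε) (controlS ε Φ) := by
  have hm : ∀ i, controlS ε Φ i ∈ weightH.domain := fun i => (displacement_mem_domain (h i) _).1
  refine ⟨hm, ?_⟩
  ext1 i
  rw [totalEnergy_apply hm, PiLp.add_apply, onSystem_systemH_apply, controlS_apply, controlS_apply,
    (displacement_mem_domain (h i) _).2, totalEnergy_apply h]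

theorem onSystem_systemH_neg (ε : n → ℝ) (Φ : TotalSpace n) :
    onSystem (systemH (-ε)) Φ = -onSystem (systemH ε) Φ := by
  ext1 i
  simp [onSystem_systemH_apply]

theorem totalEnergy_controlS_symm {Φ : TotalSpace n} (h : ∀ i, Φ i ∈ weightH.domain)
    (ε : n → ℝ) : (∀ i, (controlS ε).symm Φ i ∈ weightH.domain) ∧
      totalEnergy ((controlS ε).symm Φ) =
      (controlS ε).symm (totalEnergy Φ) - onSystem (systemH ε) ((controlS ε).symm Φ) := by
  rw [controlS_symm_eq, controlS_symm_eq]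
  refine ⟨(totalEnergy_controlS h (-ε)).1, ?_⟩
  rw [(totalEnergy_controlS h (-ε)).2, onSystem_systemH_neg, sub_eq_add_neg]

/-- `U† H_W U = H_W + S† W_S S`. -/
theorem app_heisenberg {Φ : TotalSpace n} (h : ∀ i, Φ i ∈ weightH.domain) (ε : n → ℝ)
    {V : Matrix n n ℂ} (hV : V ∈ Matrix.unitaryGroup n ℂ) :
    Φ ∈ (heisenberg (totalU ε V) (onWeight weightH)).domain ∧
      app (heisenberg (totalU ε V) (onWeight weightH)) Φ =
        totalEnergy Φ + (controlS ε).symm (onSystem (workOp ε V) (controlS ε Φ)) := by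
  have h1 := totalEnergy_controlS h ε
  have h2 := totalEnergy_onSystem h1.1 V
  have h3 := totalEnergy_controlS_symm h2.1 ε
  have hm : Φ ∈ (heisenberg (totalU ε V) (onWeight weightH)).domain := h3.1
  have hVV : V.conjTranspose * V = 1 := Matrix.mem_unitaryGroup_iff'.1 hV
  have hU : totalU ε V Φ ∈ (onWeight weightH : TotalSpace n →ₗ.[ℂ] TotalSpace n).domain := h3.1
  refine ⟨hm, ?_⟩
  have h4 : app (heisenberg (totalU ε V) (onWeight weightH)) Φ =
      ContinuousLinearMap.adjoint (totalU ε V) (totalEnergy (totalU ε V Φ)) := by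
    rw [app_of_mem hm, totalEnergy, app_of_mem hU]
    rfl
  have hc : onSystem (systemH ε) ((controlS ε).symm (onSystem V (controlS ε Φ))) =
      (controlS ε).symm (onSystem (systemH ε) (onSystem V (controlS ε Φ))) := by
    rw [controlS_symm_eq, controlS_symm_eq, controlS_onSystem_systemH]
  -- Moving `H_W` through `S† V S` produces `+H_S` to the right of `V` and `-H_S` to its left. After
  -- applying `U† = S† V† S`, what remains besides `H_W` is `S† (H_S - V† H_S V) S`.
  rw [h4, adjoint_totalU, totalU_apply, totalU_apply, h3.2, h2.2, h1.2, hc, ← map_sub,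
    LinearIsometryEquiv.apply_symm_apply, map_sub, map_add, map_add, ← onSystem_mul, ← onSystem_mul,
    hVV, onSystem_one, onSystem_one, workOp, onSystem_sub, finalH, onSystem_mul, onSystem_mul,
    add_sub_assoc, map_add, LinearIsometryEquiv.symm_apply_apply]

/-- `(H_S - H_W) S = - S H_W`. -/
theorem app_systemH_sub_weightH {Φ : TotalSpace n} (h : ∀ i, Φ i ∈ weightH.domain)
    (ε : n → ℝ) :
    controlS ε Φ ∈ (ofBounded (onSystem (systemH ε)) - onWeight weightH :
      TotalSpace n →ₗ.[ℂ] TotalSpace n).domain ∧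
    app (ofBounded (onSystem (systemH ε)) - onWeight weightH) (controlS ε Φ) =
      -controlS ε (totalEnergy Φ) := by
  have h1 := totalEnergy_controlS h ε
  have hm : controlS ε Φ ∈ (ofBounded (onSystem (systemH ε)) - onWeight weightH :
      TotalSpace n →ₗ.[ℂ] TotalSpace n).domain := ⟨trivial, h1.1⟩
  refine ⟨hm, ?_⟩
  have h2 : app (ofBounded (onSystem (systemH ε)) - onWeight weightH) (controlS ε Φ) =
      onSystem (systemH ε) (controlS ε Φ) - totalEnergy (controlS ε Φ) := by
    rw [app_of_mem hm, LinearPMap.sub_apply, totalEnergy, app_of_mem (mem_onWeight_domain.2 h1.1)]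
    rfl
  rw [h2, h1.2]
  abel

theorem app_ofBounded {H : Type*} [NormedAddCommGroup H] [InnerProductSpace ℂ H]
    (T : H →L[ℂ] H) (x : H) : app (ofBounded T) x = T x :=
  app_of_mem (A := ofBounded T) trivial

end Operators

theorem hasSum_of_forall_eq {α : Type*} {f g : α → ℂ} {a : ℂ} (hg : HasSum g a)
    (h : ∀ x, f x = g x) : HasSum f a := by rwa [funext h]

theorem hasSum_mul_prod {κ ι : Type*} {f : κ → ℂ} {g : ι → ℂ} (hf : Summable fun k => ‖f k‖)
    (hg : Summable fun l => ‖g l‖) :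
    HasSum (fun K : κ × ι => f K.1 * g K.2) ((∑' k, f k) * ∑' l, g l) := by
  have hs : Summable fun K : κ × ι => f K.1 * g K.2 := summable_mul_of_summable_norm hf hg
  exact HasSum.mul hf.of_norm.hasSum hg.of_norm.hasSum hs

section Moments

variable {n κ ι : Type*} [Fintype n]

/-! ### Second moments -/

section

variable {ρS : MixedState κ (EuclideanSpace ℂ n)} {ρW : MixedState ι WeightSpace}

theorem p_ne_zero_of_prodState {K : κ × ι} (h : (prodState ρS ρW).p K ≠ 0) : ρW.p K.2 ≠ 0 :=
  right_ne_zero_of_mul (a := ρS.p K.1) h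

theorem tensor_mem_domain (hρW : ρW.FiniteSecondMoment weightH) {K : κ × ι}
    (h : (prodState ρS ρW).p K ≠ 0) : ∀ i, (prodState ρS ρW).ψ K i ∈ weightH.domain :=
  (totalEnergy_tensor _ (hρW.mem_domain (p_ne_zero_of_prodState h))).1

theorem totalEnergy_prodState (hρW : ρW.FiniteSecondMoment weightH) {K : κ × ι}
    (h : (prodState ρS ρW).p K ≠ 0) : totalEnergy ((prodState ρS ρW).ψ K) =
      tensor (ρS.ψ K.1) (energy (ρW.ψ K.2)) :=
  (totalEnergy_tensor _ (hρW.mem_domain (p_ne_zero_of_prodState h))).2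

theorem summable_norm_tensor_energy (hρW : ρW.FiniteSecondMoment weightH) :
    Summable fun K => (prodState ρS ρW).p K *
      ‖tensor (ρS.ψ K.1) (energy (ρW.ψ K.2))‖ ^ 2 := by
  refine (ρS.hasSum_p.summable.mul_of_nonneg hρW.2 ρS.p_nonneg
    fun l => mul_nonneg (ρW.p_nonneg l) (sq_nonneg _)).congr fun K => ?_
  rw [norm_tensor, ρS.norm_ψ, one_mul]
  simp only [prodState, mul_assoc]

theorem finiteSecondMoment_onWeight (hρW : ρW.FiniteSecondMoment weightH) :
    (prodState ρS ρW).FiniteSecondMoment (onWeight weightH) := by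
  refine ⟨fun K hK => tensor_mem_domain hρW hK,
    (summable_norm_tensor_energy (ρS := ρS) hρW).congr fun K => ?_⟩
  by_cases hK : (prodState ρS ρW).p K = 0
  · simp [hK]
  · rw [← totalEnergy_prodState hρW hK]

/-- `U† H_W U` is a bounded perturbation of `H_W`, and `‖a + b‖² ≤ 2‖a‖² + 2‖b‖²`. -/
theorem finiteSecondMoment_heisenberg [DecidableEq n] (hρW : ρW.FiniteSecondMoment weightH)
    (ε : n → ℝ) {V : Matrix n n ℂ} (hV : V ∈ Matrix.unitaryGroup n ℂ) :
    (prodState ρS ρW).FiniteSecondMoment (heisenberg (totalU ε V) (onWeight weightH)) := by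
  refine ⟨fun K hK => (app_heisenberg (tensor_mem_domain hρW hK) ε hV).1, ?_⟩
  have hs := (((summable_norm_tensor_energy (ρS := ρS) hρW).mul_left 2).add
    ((prodState ρS ρW).hasSum_p.summable.mul_left (2 * ‖onSystem (workOp ε V)‖ ^ 2)))
  refine Summable.of_nonneg_of_le
    (fun K => mul_nonneg ((prodState ρS ρW).p_nonneg K) (sq_nonneg _)) (fun K => ?_) hs
  by_cases hK : (prodState ρS ρW).p K = 0
  · simp [hK]
  · rw [(app_heisenberg (tensor_mem_domain hρW hK) ε hV).2, totalEnergy_prodState hρW hK]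
    set a := tensor (ρS.ψ K.1) (energy (ρW.ψ K.2))
    set b := (controlS ε).symm (onSystem (workOp ε V) (controlS ε ((prodState ρS ρW).ψ K)))
    have hb : ‖b‖ ≤ ‖onSystem (workOp ε V)‖ := by
      rw [LinearIsometryEquiv.norm_map]
      refine (ContinuousLinearMap.le_opNorm _ _).trans ?_
      rw [LinearIsometryEquiv.norm_map, (prodState ρS ρW).norm_ψ, mul_one]
    have h1 : ‖a + b‖ ^ 2 ≤ 2 * ‖a‖ ^ 2 + 2 * ‖onSystem (workOp ε V)‖ ^ 2 := by
      have h2 : ‖a + b‖ ≤ ‖a‖ + ‖onSystem (workOp ε V)‖ :=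
        (norm_add_le _ _).trans (by gcongr)
      calc ‖a + b‖ ^ 2 ≤ (‖a‖ + ‖onSystem (workOp ε V)‖) ^ 2 := by gcongr
        _ ≤ _ := by nlinarith [sq_nonneg (‖a‖ - ‖onSystem (workOp ε V)‖)]
    nlinarith [mul_le_mul_of_nonneg_left h1 ((prodState ρS ρW).p_nonneg K)]

theorem finiteSecondMoment_systemH_sub_weightH [DecidableEq n]
    (hρW : ρW.FiniteSecondMoment weightH) (ε : n → ℝ) :
    (controlState ε ρS ρW).FiniteSecondMoment
      (ofBounded (onSystem (systemH ε)) - onWeight weightH) := by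
  refine ⟨fun K hK => (app_systemH_sub_weightH (tensor_mem_domain hρW hK) ε).1,
    (summable_norm_tensor_energy (ρS := ρS) hρW).congr fun K => ?_⟩
  by_cases hK : (prodState ρS ρW).p K = 0
  · simp [hK, controlState, MixedState.map]
  · have := (app_systemH_sub_weightH (tensor_mem_domain hρW hK) ε).2
    simp only [controlState, MixedState.map] at this ⊢
    rw [this, norm_neg, LinearIsometryEquiv.norm_map, totalEnergy_prodState hρW hK]

end

/-! ### Expectations in the control state -/

/-- `∑ᵢⱼ Mᵢⱼ (ρ_S)ⱼᵢ g(εⱼ - εᵢ)`. -/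
def weightedTrace (ε : n → ℝ) (ρS : MixedState κ (EuclideanSpace ℂ n)) (M : Matrix n n ℂ)
    (g : ℝ → ℂ) : ℂ :=
  ∑ i, ∑ j, M i j * (densityMatrix ρS j i * g (ε j - ε i))

theorem weightedTrace_sub (ε : n → ℝ) (ρS : MixedState κ (EuclideanSpace ℂ n))
    (M N : Matrix n n ℂ) (g : ℝ → ℂ) : weightedTrace ε ρS (M - N) g =
      weightedTrace ε ρS M g - weightedTrace ε ρS N g := by
  simp only [weightedTrace, Matrix.sub_apply, sub_mul, Finset.sum_sub_distrib]

/-- A diagonal matrix has no energy gaps, so it sees `g` only at `0`. This makes `H_S` drop out of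
`F`. -/
theorem weightedTrace_systemH [DecidableEq n] (ε : n → ℝ)
    (ρS : MixedState κ (EuclideanSpace ℂ n)) (g : ℝ → ℂ) :
    weightedTrace ε ρS (systemH ε) g = (∑ i, (ε i : ℂ) * densityMatrix ρS i i) * g 0 := by
  simp only [weightedTrace, systemH, Matrix.diagonal_apply, Finset.sum_mul]
  refine Finset.sum_congr rfl fun i _ => ?_
  rw [Finset.sum_eq_single i]
  · simp [mul_assoc]
  · intro j _ hj
    simp [hj.symm]
  · simp

theorem norm_coord_le (ρS : MixedState κ (EuclideanSpace ℂ n)) (k : κ) (i : n) :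
    ‖ρS.ψ k i‖ ≤ 1 := (PiLp.norm_apply_le _ i).trans (ρS.norm_ψ k).le

theorem summable_norm_densityMatrix (ρS : MixedState κ (EuclideanSpace ℂ n)) (i j : n) :
    Summable fun k => ‖(ρS.p k : ℂ) * (ρS.ψ k i * conj (ρS.ψ k j))‖ := by
  refine Summable.of_nonneg_of_le (fun _ => norm_nonneg _) (fun k => ?_) ρS.hasSum_p.summable
  rw [norm_mul, norm_mul, Complex.norm_real, Real.norm_of_nonneg (ρS.p_nonneg k), RCLike.norm_conj]
  exact mul_le_of_le_one_right (ρS.p_nonneg k)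
    (mul_le_one₀ (norm_coord_le _ _ _) (norm_nonneg _) (norm_coord_le _ _ _))

variable {ρS : MixedState κ (EuclideanSpace ℂ n)} {ρW : MixedState ι WeightSpace}

/-- The double series factors: the sum over `κ` builds `ρ_S`, and the sum over `ι` builds the
function of the gap. -/
theorem hasSum_weightedTrace (ε : n → ℝ) (M : Matrix n n ℂ) {b : ι → ℝ → ℂ}
    (hb : ∀ ω, Summable fun l => ‖(ρW.p l : ℂ) * b l ω‖) :
    HasSum (fun K => ((prodState ρS ρW).p K : ℂ) * ∑ i, ∑ j, M i j *
      (conj (ρS.ψ K.1 i) * ρS.ψ K.1 j * b K.2 (ε j - ε i)))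
      (weightedTrace ε ρS M fun ω => ∑' l, (ρW.p l : ℂ) * b l ω) := by
  simp only [weightedTrace]
  have h1 : ∀ i j, HasSum (fun K : κ × ι => M i j * (((ρS.p K.1 : ℂ) *
      (ρS.ψ K.1 j * conj (ρS.ψ K.1 i))) * ((ρW.p K.2 : ℂ) * b K.2 (ε j - ε i))))
      (M i j * (densityMatrix ρS j i * ∑' l, (ρW.p l : ℂ) * b l (ε j - ε i))) := fun i j =>
    (hasSum_mul_prod (f := fun k => (ρS.p k : ℂ) * (ρS.ψ k j * conj (ρS.ψ k i)))
      (g := fun l => (ρW.p l : ℂ) * b l (ε j - ε i)) (summable_norm_densityMatrix ρS j i)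
      (hb _)).mul_left (M i j)
  have h2 := hasSum_sum (s := Finset.univ) fun i _ =>
    hasSum_sum (s := Finset.univ) fun j _ => h1 i j
  refine hasSum_of_forall_eq h2 fun K => ?_
  simp only [Finset.mul_sum, prodState, Complex.ofReal_mul]
  refine Finset.sum_congr rfl fun i _ => Finset.sum_congr rfl fun j _ => ?_
  ring

/-- Only the relative translation of components `i` and `j` matters, by unitarity of the
displacements. -/
theorem inner_controlS_tensor (ε : n → ℝ) (M : Matrix n n ℂ) (v : EuclideanSpace ℂ n)
    (f g : WeightSpace) :
    inner ℂ (controlS ε (tensor v f)) (onSystem M (controlS ε (tensor v g))) =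
      ∑ i, ∑ j, M i j * (conj (v i) * v j * inner ℂ (displacement (-(ε j - ε i)) f) g) := by
  rw [inner_onSystem_right]
  refine Finset.sum_congr rfl fun i _ => Finset.sum_congr rfl fun j _ => ?_
  rw [controlS_apply, controlS_apply, inner_displacement_displacement, neg_sub]
  simp only [tensor, map_smul, inner_smul_left, inner_smul_right]
  ring

theorem norm_p_mul_inner_le (l : ι) {f g : WeightSpace} {c : ℝ} (h : ‖f‖ * ‖g‖ ≤ c) :
    ‖(ρW.p l : ℂ) * inner ℂ f g‖ ≤ ρW.p l * c := by
  rw [norm_mul, Complex.norm_real, Real.norm_of_nonneg (ρW.p_nonneg l)]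
  exact mul_le_mul_of_nonneg_left ((norm_inner_le_norm f g).trans h) (ρW.p_nonneg l)

theorem summable_overlap (ω : ℝ) : Summable fun l =>
    ‖(ρW.p l : ℂ) * inner ℂ (displacement (-ω) (ρW.ψ l)) (ρW.ψ l)‖ := by
  refine Summable.of_nonneg_of_le (fun _ => norm_nonneg _)
    (fun l => norm_p_mul_inner_le l (c := 1) ?_) (by simpa using ρW.hasSum_p.summable)
  rw [LinearIsometryEquiv.norm_map, ρW.norm_ψ, one_mul]

theorem summable_energyOverlap (hρW : ρW.FiniteSecondMoment weightH) (ω : ℝ) : Summable fun l =>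
    ‖(ρW.p l : ℂ) * ((1 / 2 : ℂ) * (inner ℂ (displacement (-ω) (energy (ρW.ψ l))) (ρW.ψ l) +
      inner ℂ (displacement (-ω) (ρW.ψ l)) (energy (ρW.ψ l))))‖ := by
  refine Summable.of_nonneg_of_le (fun _ => norm_nonneg _) (fun l => ?_) hρW.summable_energy
  have h1 := norm_p_mul_inner_le (ρW := ρW) l (f := displacement (-ω) (energy (ρW.ψ l)))
    (g := ρW.ψ l) (c := ‖energy (ρW.ψ l)‖)
    (by rw [LinearIsometryEquiv.norm_map, ρW.norm_ψ, mul_one])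
  have h2 := norm_p_mul_inner_le (ρW := ρW) l (f := displacement (-ω) (ρW.ψ l))
    (g := energy (ρW.ψ l)) (c := ‖energy (ρW.ψ l)‖)
    (by rw [LinearIsometryEquiv.norm_map, ρW.norm_ψ, one_mul])
  rw [mul_left_comm, mul_add, norm_mul]
  have h3 := (norm_add_le _ _).trans (add_le_add h1 h2)
  have : ‖(1 / 2 : ℂ)‖ = 1 / 2 := by norm_num
  rw [this]
  linarith

theorem hasSum_inner_onSystem (ε : n → ℝ) (M : Matrix n n ℂ) :
    HasSum (fun K => ((prodState ρS ρW).p K : ℂ) *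
      inner ℂ (controlS ε (tensor (ρS.ψ K.1) (ρW.ψ K.2)))
        (onSystem M (controlS ε (tensor (ρS.ψ K.1) (ρW.ψ K.2)))))
      (weightedTrace ε ρS M (overlap ρW)) := by
  simp only [inner_controlS_tensor]
  exact hasSum_weightedTrace ε M
    (b := fun l ω => inner ℂ (displacement (-ω) (ρW.ψ l)) (ρW.ψ l)) summable_overlap

theorem hasSum_inner_energy_onSystem (hρW : ρW.FiniteSecondMoment weightH) (ε : n → ℝ)
    {M : Matrix n n ℂ} (hM : M.IsHermitian) :
    HasSum (fun K => ((prodState ρS ρW).p K : ℂ) * ((1 / 2 : ℂ) *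
      (inner ℂ (controlS ε (tensor (ρS.ψ K.1) (energy (ρW.ψ K.2))))
        (onSystem M (controlS ε (tensor (ρS.ψ K.1) (ρW.ψ K.2)))) +
      inner ℂ (onSystem M (controlS ε (tensor (ρS.ψ K.1) (ρW.ψ K.2))))
        (controlS ε (tensor (ρS.ψ K.1) (energy (ρW.ψ K.2)))))))
      (weightedTrace ε ρS M (energyOverlap ρW)) := by
  refine hasSum_of_forall_eq (hasSum_weightedTrace ε M
    (b := fun l ω => (1 / 2 : ℂ) * (inner ℂ (displacement (-ω) (energy (ρW.ψ l))) (ρW.ψ l) +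
      inner ℂ (displacement (-ω) (ρW.ψ l)) (energy (ρW.ψ l)))) (summable_energyOverlap hρW))
    fun K => ?_
  rw [inner_onSystem_left, hM.eq, inner_controlS_tensor, inner_controlS_tensor,
    ← Finset.sum_add_distrib, Finset.mul_sum]
  congr 1
  refine Finset.sum_congr rfl fun i _ => ?_
  rw [← Finset.sum_add_distrib, Finset.mul_sum]
  refine Finset.sum_congr rfl fun j _ => ?_
  ring

theorem inner_tensor (v : EuclideanSpace ℂ n) (hv : ‖v‖ = 1) (f g : WeightSpace) :
    inner ℂ (tensor v f) (tensor v g) = inner ℂ f g := by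
  have h : inner ℂ v v = (1 : ℂ) := by rw [inner_self_eq_norm_sq_to_K, hv]; simp
  rw [PiLp.inner_apply] at h
  rw [PiLp.inner_apply]
  simp only [tensor, inner_smul_left, inner_smul_right]
  refine Eq.trans ?_ ((congrArg (· * inner ℂ f g) h).trans (one_mul _))
  simp only [Finset.sum_mul]
  refine Finset.sum_congr rfl fun i _ => ?_
  rw [RCLike.inner_apply]
  ring

/-- At `ω = 0` the symmetry of `H_W` merges the two halves of `energyOverlap` into `⟨H_W⟩`. -/
theorem hasSum_inner_energy (hρW : ρW.FiniteSecondMoment weightH) :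
    HasSum (fun K => ((prodState ρS ρW).p K : ℂ) *
      inner ℂ (tensor (ρS.ψ K.1) (ρW.ψ K.2)) (tensor (ρS.ψ K.1) (energy (ρW.ψ K.2))))
      (energyOverlap ρW 0) := by
  have h1 := summable_energyOverlap hρW 0
  have hp : Summable fun k => ‖(ρS.p k : ℂ)‖ := by
    simpa only [Complex.norm_real] using ρS.hasSum_p.summable.norm
  have h2 := hasSum_mul_prod hp h1
  rw [(Complex.hasSum_ofReal.2 ρS.hasSum_p).tsum_eq, Complex.ofReal_one, one_mul] at h2
  refine hasSum_of_forall_eq h2 fun K => ?_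
  rw [inner_tensor _ (ρS.norm_ψ _)]
  by_cases hK : ρW.p K.2 = 0
  · simp [prodState, hK]
  · have hd := hρW.mem_domain hK
    rw [neg_zero, displacement_zero, displacement_zero, inner_energy_comm hd hd]
    simp only [prodState]
    push_cast
    ring

end Moments

/-! ### Mean, variance and `F` as weighted traces -/

section Result

theorem isHermitian_systemH {n : Type*} [DecidableEq n] (ε : n → ℝ) : (systemH ε).IsHermitian :=
  Matrix.isHermitian_diagonal_of_self_adjoint _ (by ext i; simp)

variable {n κ ι : Type*} [Fintype n]

theorem inner_symm_right {H : Type*} [NormedAddCommGroup H] [InnerProductSpace ℂ H]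
    (S : H ≃ₗᵢ[ℂ] H) (x y : H) : inner ℂ x (S.symm y) = inner ℂ (S x) y := by
  rw [← S.inner_map_map, S.apply_symm_apply]

variable {ρS : MixedState κ (EuclideanSpace ℂ n)} {ρW : MixedState ι WeightSpace}

/-- `⟨H_W⟩_ρ` in the product state. -/
theorem expect_onWeight (hρW : ρW.FiniteSecondMoment weightH) :
    (prodState ρS ρW).expect (onWeight weightH) = energyOverlap ρW 0 := by
  refine (hasSum_of_forall_eq (hasSum_inner_energy (ρS := ρS) hρW) fun K => ?_).tsum_eq
  by_cases hK : (prodState ρS ρW).p K = 0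
  · rw [hK, Complex.ofReal_zero, zero_mul, zero_mul]
  · have h : app (onWeight weightH) ((prodState ρS ρW).ψ K) = _ := totalEnergy_prodState hρW hK
    rw [h]
    rfl

theorem matExpect_add (ρ A B : Matrix n n ℂ) :
    matExpect ρ (A + B) = matExpect ρ A + matExpect ρ B := by
  rw [matExpect, add_mul, Matrix.trace_add, matExpect, matExpect]

/-- The weight acts on `ρ_S` as an entrywise (Schur) multiplier: coherences are damped by the
overlap of the translated wave functions. -/
theorem controlMarginal_apply (ε : n → ℝ) (i j : n) :
    controlMarginal ε ρS ρW i j = densityMatrix ρS i j * overlap ρW (ε i - ε j) := by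
  refine (hasSum_of_forall_eq (hasSum_mul_prod (summable_norm_densityMatrix ρS i j)
    (summable_overlap (ρW := ρW) (ε i - ε j))) fun K => ?_).tsum_eq
  change ((ρS.p K.1 * ρW.p K.2 : ℝ) : ℂ) *
    inner ℂ (displacement (ε j) (ρS.ψ K.1 j • ρW.ψ K.2))
      (displacement (ε i) (ρS.ψ K.1 i • ρW.ψ K.2)) = _
  rw [inner_displacement_displacement, neg_sub, map_smul, inner_smul_left, inner_smul_right]
  push_cast
  ring

theorem matExpect_controlMarginal (ε : n → ℝ) (M : Matrix n n ℂ) :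
    matExpect (controlMarginal ε ρS ρW) M = weightedTrace ε ρS M (overlap ρW) := by
  simp only [matExpect, Matrix.trace, Matrix.diag_apply, Matrix.mul_apply, weightedTrace,
    controlMarginal_apply]

/-- Only the existence of `⟨H_W²⟩` is needed, since its value cancels in `deltaVar`. -/
theorem hasSum_norm_sq_energy (hρW : ρW.FiniteSecondMoment weightH) :
    ∃ a : ℂ, HasSum (fun K => ((prodState ρS ρW).p K : ℂ) *
      inner ℂ (tensor (ρS.ψ K.1) (energy (ρW.ψ K.2)))
        (tensor (ρS.ψ K.1) (energy (ρW.ψ K.2)))) a := by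
  have h := Complex.hasSum_ofReal.2 (summable_norm_tensor_energy (ρS := ρS) hρW).hasSum
  refine ⟨_, hasSum_of_forall_eq h fun K => ?_⟩
  rw [inner_self_eq_norm_sq_to_K]
  push_cast
  rfl

theorem var_onWeight {a : ℂ} (hρW : ρW.FiniteSecondMoment weightH)
    (ha : HasSum (fun K => ((prodState ρS ρW).p K : ℂ) *
      inner ℂ (tensor (ρS.ψ K.1) (energy (ρW.ψ K.2)))
        (tensor (ρS.ψ K.1) (energy (ρW.ψ K.2)))) a) :
    (prodState ρS ρW).var (onWeight weightH) = a - energyOverlap ρW 0 ^ 2 := by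
  rw [MixedState.var, MixedState.cov, expect_onWeight hρW, sq]
  congr 1
  refine (hasSum_of_forall_eq ha fun K => ?_).tsum_eq
  by_cases hK : (prodState ρS ρW).p K = 0
  · rw [hK, Complex.ofReal_zero, zero_mul, zero_mul]
  · have h : app (onWeight weightH) ((prodState ρS ρW).ψ K) = _ := totalEnergy_prodState hρW hK
    rw [h]
    ring

variable [DecidableEq n]

theorem isHermitian_finalH (ε : n → ℝ) (V : Matrix n n ℂ) : (finalH ε V).IsHermitian :=
  Matrix.isHermitian_conjTranspose_mul_mul V (isHermitian_systemH ε)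

theorem isHermitian_workOp (ε : n → ℝ) (V : Matrix n n ℂ) : (workOp ε V).IsHermitian :=
  (isHermitian_systemH ε).sub (isHermitian_finalH ε V)

theorem expect_heisenberg (hρW : ρW.FiniteSecondMoment weightH) (ε : n → ℝ) {V : Matrix n n ℂ}
    (hV : V ∈ Matrix.unitaryGroup n ℂ) :
    (prodState ρS ρW).expect (heisenberg (totalU ε V) (onWeight weightH)) =
      energyOverlap ρW 0 + weightedTrace ε ρS (workOp ε V) (overlap ρW) := by
  refine (hasSum_of_forall_eq ((hasSum_inner_energy (ρS := ρS) hρW).add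
    (hasSum_inner_onSystem ε (workOp ε V))) fun K => ?_).tsum_eq
  by_cases hK : (prodState ρS ρW).p K = 0
  · simp only [hK, Complex.ofReal_zero, zero_mul, add_zero]
  · rw [(app_heisenberg (tensor_mem_domain hρW hK) ε hV).2, totalEnergy_prodState hρW hK,
      inner_add_right, inner_symm_right, mul_add]
    rfl

theorem deltaE_eq (hρW : ρW.FiniteSecondMoment weightH) (ε : n → ℝ) {V : Matrix n n ℂ}
    (hV : V ∈ Matrix.unitaryGroup n ℂ) :
    deltaE ε V ρS ρW = matExpect (controlMarginal ε ρS ρW) (workOp ε V) := by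
  rw [deltaE, expect_heisenberg hρW ε hV, expect_onWeight hρW, matExpect_controlMarginal]
  ring

/-- `(H_S - H_W) S = -S H_W` turns the covariance with `V_S† H_S V_S` into minus the same expression
for `finalH`. That expression vanishes for `H_S`, so `finalH` may be traded for `-W_S`. -/
theorem fTerm_eq_weightedTrace (hρW : ρW.FiniteSecondMoment weightH) (ε : n → ℝ)
    (V : Matrix n n ℂ) : fTerm ε V ρS ρW = weightedTrace ε ρS (workOp ε V) (energyOverlap ρW) -
      energyOverlap ρW 0 * weightedTrace ε ρS (workOp ε V) (overlap ρW) := by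
  have happ : ∀ K, (prodState ρS ρW).p K ≠ 0 →
      app (ofBounded (onSystem (systemH ε)) - onWeight weightH) ((controlState ε ρS ρW).ψ K) =
        -controlS ε (tensor (ρS.ψ K.1) (energy (ρW.ψ K.2))) := fun K hK => by
    rw [← totalEnergy_prodState hρW hK]
    exact (app_systemH_sub_weightH (tensor_mem_domain hρW hK) ε).2
  have h1 : (controlState ε ρS ρW).expect (ofBounded (onSystem (systemH ε)) - onWeight weightH) =
      -energyOverlap ρW 0 := by
    refine (hasSum_of_forall_eq (hasSum_inner_energy (ρS := ρS) hρW).neg fun K => ?_).tsum_eq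
    change ((prodState ρS ρW).p K : ℂ) * inner ℂ ((controlState ε ρS ρW).ψ K) _ = _
    by_cases hK : (prodState ρS ρW).p K = 0
    · rw [hK, Complex.ofReal_zero, zero_mul, zero_mul, neg_zero]
    · rw [happ K hK, inner_neg_right, mul_neg, neg_inj]
      congr 1
      exact (controlS ε).inner_map_map _ _
  have h2 : (controlState ε ρS ρW).expect (ofBounded (onSystem (finalH ε V))) =
      weightedTrace ε ρS (finalH ε V) (overlap ρW) := by
    refine (hasSum_of_forall_eq (hasSum_inner_onSystem ε (finalH ε V)) fun K => ?_).tsum_eq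
    rw [app_ofBounded]
    rfl
  have h3 := (hasSum_of_forall_eq (hasSum_inner_energy_onSystem (ρS := ρS) hρW ε
    (isHermitian_finalH ε V)).neg (f := fun K => ((controlState ε ρS ρW).p K : ℂ) * ((1 / 2 : ℂ) *
      (inner ℂ (app (ofBounded (onSystem (systemH ε)) - onWeight weightH)
          ((controlState ε ρS ρW).ψ K))
        (app (ofBounded (onSystem (finalH ε V))) ((controlState ε ρS ρW).ψ K)) +
      inner ℂ (app (ofBounded (onSystem (finalH ε V))) ((controlState ε ρS ρW).ψ K))
        (app (ofBounded (onSystem (systemH ε)) - onWeight weightH)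
          ((controlState ε ρS ρW).ψ K))))) fun K => ?_).tsum_eq
  · rw [fTerm, MixedState.cov, h1, h2, h3, workOp, weightedTrace_sub, weightedTrace_sub,
      weightedTrace_systemH, weightedTrace_systemH, overlap_zero]
    ring
  · change ((prodState ρS ρW).p K : ℂ) * _ = _
    by_cases hK : (prodState ρS ρW).p K = 0
    · rw [hK, Complex.ofReal_zero, zero_mul, zero_mul, neg_zero]
    · rw [happ K hK, app_ofBounded, inner_neg_right, inner_neg_left, ← neg_add, mul_neg, mul_neg]
      rfl

/-- After applying `S`, this expands `‖S H_W Φ + W_S S Φ‖²`; the cross terms are the symmetrized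
product of `H_W` and `S† W_S S`. -/
theorem var_heisenberg {a : ℂ} (hρW : ρW.FiniteSecondMoment weightH) (ε : n → ℝ)
    {V : Matrix n n ℂ} (hV : V ∈ Matrix.unitaryGroup n ℂ)
    (ha : HasSum (fun K => ((prodState ρS ρW).p K : ℂ) *
      inner ℂ (tensor (ρS.ψ K.1) (energy (ρW.ψ K.2)))
        (tensor (ρS.ψ K.1) (energy (ρW.ψ K.2)))) a) :
    (prodState ρS ρW).var (heisenberg (totalU ε V) (onWeight weightH)) =
      a + 2 * weightedTrace ε ρS (workOp ε V) (energyOverlap ρW) +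
        weightedTrace ε ρS (workOp ε V * workOp ε V) (overlap ρW) -
        (energyOverlap ρW 0 + weightedTrace ε ρS (workOp ε V) (overlap ρW)) ^ 2 := by
  rw [MixedState.var, MixedState.cov, expect_heisenberg hρW ε hV, sq]
  congr 1
  refine (hasSum_of_forall_eq ((ha.add ((hasSum_inner_energy_onSystem hρW ε
    (isHermitian_workOp ε V)).mul_left 2)).add
    (hasSum_inner_onSystem ε (workOp ε V * workOp ε V))) fun K => ?_).tsum_eq
  by_cases hK : (prodState ρS ρW).p K = 0
  · simp only [hK, Complex.ofReal_zero, zero_mul, add_zero, mul_zero]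
  · rw [(app_heisenberg (tensor_mem_domain hρW hK) ε hV).2, totalEnergy_prodState hρW hK]
    rw [← (controlS ε).inner_map_map, map_add, (controlS ε).apply_symm_apply, onSystem_mul,
      ← (controlS ε).inner_map_map (tensor (ρS.ψ K.1) (energy (ρW.ψ K.2)))]
    have hW : ∀ x : TotalSpace n, inner ℂ x (onSystem (workOp ε V) (onSystem (workOp ε V) x)) =
        inner ℂ (onSystem (workOp ε V) x) (onSystem (workOp ε V) x) := fun x => by
      rw [inner_onSystem_left, (isHermitian_workOp ε V).eq]
    rw [hW]
    have hψ : (prodState ρS ρW).ψ K = tensor (ρS.ψ K.1) (ρW.ψ K.2) := rfl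
    simp only [hψ, inner_add_left, inner_add_right]
    ring

theorem deltaVar_eq (hρW : ρW.FiniteSecondMoment weightH) (ε : n → ℝ) {V : Matrix n n ℂ}
    (hV : V ∈ Matrix.unitaryGroup n ℂ) : deltaVar ε V ρS ρW =
      matVar (controlMarginal ε ρS ρW) (workOp ε V) + 2 * fTerm ε V ρS ρW := by
  obtain ⟨a, ha⟩ := hasSum_norm_sq_energy (ρS := ρS) hρW
  rw [deltaVar, var_heisenberg hρW ε hV ha, var_onWeight hρW ha, fTerm_eq_weightedTrace hρW,
    matVar, matCov, matExpect_add, matExpect_controlMarginal, matExpect_controlMarginal]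
  ring

/-! ### The operator `ξ_S` -/

theorem freeEvol_eq (ε : n → ℝ) (t : ℝ) :
    freeEvol ε t = Matrix.diagonal fun i => Complex.exp (-(Complex.I * ε i * t)) := by
  rw [freeEvol, systemH, ← Matrix.diagonal_smul, Matrix.exp_diagonal]
  congr 1
  funext i
  rw [Pi.coe_exp, Pi.smul_apply, smul_eq_mul, Complex.exp_eq_exp_ℂ]
  congr 1
  ring

theorem freeEvol_conj_apply (ε : n → ℝ) (M : Matrix n n ℂ) (t : ℝ) (i j : n) :
    (freeEvol ε t * M * freeEvol ε (-t)) i j =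
      M i j * Complex.exp (-(Complex.I * (ε i - ε j : ℝ) * t)) := by
  rw [freeEvol_eq, freeEvol_eq, Matrix.mul_diagonal, Matrix.diagonal_mul, mul_right_comm,
    ← Complex.exp_add, mul_comm]
  congr 2
  push_cast
  ring

variable [Countable ι]

/-- Free evolution multiplies the `(i, j)` entry by `e^{-i(εᵢ - εⱼ)t}`, so the `t`-integral is a
Fourier coefficient at the gap `εᵢ - εⱼ`. -/
theorem xi_apply (hρW : ρW.FiniteSecondMoment weightH) (ε : n → ℝ) (s : ℝ) (i j : n) :
    xi ε ρS ρW s i j = densityMatrix ρS i j * fourierCoeff (ε i - ε j) (wignerCurve ρW s) /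
      fourierCoeff 0 (wignerCurve ρW s) := by
  rw [xi, Matrix.of_apply, expect_phase hρW, ← integral_exp_mul_wignerTransform hρW (ε i - ε j),
    ← integral_const_mul]
  congr 2 with t
  rw [integral_mul_const, freeEvol_conj_apply, wignerTransform]
  ring

/-- Quotient rule with denominator `1` at `s = 0`: normalizing `ξ_S` is what produces the centering
term of the covariance. -/
theorem hasDerivAt_xi (hρW : ρW.FiniteSecondMoment weightH) (ε : n → ℝ) (i j : n) :
    HasDerivAt (fun s => xi ε ρS ρW s i j) (Complex.I * (densityMatrix ρS i j *
      (energyOverlap ρW (ε i - ε j) - energyOverlap ρW 0 * overlap ρW (ε i - ε j)))) 0 := by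
  simp only [xi_apply hρW]
  have h0 : fourierCoeff 0 (wignerCurve ρW 0) = 1 := by
    rw [fourierCoeff_wignerCurve_zero hρW, overlap_zero]
  have h := ((hasDerivAt_fourierCoeff_wignerCurve hρW (ε i - ε j)).const_mul
    (densityMatrix ρS i j)).div (hasDerivAt_fourierCoeff_wignerCurve hρW 0) (by rw [h0]; simp)
  refine h.congr_deriv ?_
  rw [h0, fourierCoeff_wignerCurve_zero hρW]
  ring

theorem fTerm_eq_trace_xiDerivZero (hρW : ρW.FiniteSecondMoment weightH) (ε : n → ℝ)
    (V : Matrix n n ℂ) : fTerm ε V ρS ρW =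
      -Complex.I * (workOp ε V * xiDerivZero ε ρS ρW).trace := by
  simp only [fTerm_eq_weightedTrace hρW, Matrix.trace, Matrix.diag_apply, Matrix.mul_apply,
    xiDerivZero, Matrix.of_apply, (hasDerivAt_xi hρW ε _ _).deriv, weightedTrace, Finset.mul_sum,
    ← Finset.sum_sub_distrib]
  refine Finset.sum_congr rfl fun i _ => Finset.sum_congr rfl fun j _ => ?_
  linear_combination (workOp ε V i j * (densityMatrix ρS j i * (energyOverlap ρW (ε j - ε i) -
    energyOverlap ρW 0 * overlap ρW (ε j - ε i)))) * Complex.I_mul_I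

/-! ### The Wigner form of `F` -/

theorem trace_workOpAt_mul (ε : n → ℝ) (V M : Matrix n n ℂ) (t : ℝ) :
    (workOpAt ε V t * M).trace = ∑ i, ∑ j, workOp ε V i j *
      (M j i * Complex.exp (-(Complex.I * (ε j - ε i : ℝ) * t))) := by
  have h : ∀ i j, workOpAt ε V t i j =
      workOp ε V i j * Complex.exp (-(Complex.I * (ε j - ε i : ℝ) * t)) := fun i j => by
    have := freeEvol_conj_apply ε (workOp ε V) (-t) i j
    rw [neg_neg] at this
    rw [workOpAt, this]
    congr 2
    push_cast
    ring
  simp only [Matrix.trace, Matrix.diag_apply, Matrix.mul_apply, h]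
  refine Finset.sum_congr rfl fun i _ => Finset.sum_congr rfl fun j _ => ?_
  ring

/-- The first centered moment of the Wigner function in the energy, as an element of `L¹`. -/
theorem coeFn_centered_ae_eq (hρW : ρW.FiniteSecondMoment weightH) (m : ℂ)
    (h : ∀ᵐ t : ℝ, Integrable fun E : ℝ => ((E : ℂ) - m) * wigner ρW E t) :
    (((-Complex.I) • wignerCurveDeriv ρW - m • wignerCurve ρW 0 :
      Lp ℂ 1 (volume : Measure ℝ)) : ℝ → ℂ) =ᵐ[volume] fun τ => (2 * Real.pi : ℂ) *
        ∫ E : ℝ, ((E : ℂ) - m) * wigner ρW E (2 * Real.pi * τ) := by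
  -- `W(·,t)` is itself integrable, so the centering does not affect convergence.
  have hE : ∀ᵐ t : ℝ, Integrable fun E : ℝ => (E : ℂ) * wigner ρW E t := by
    filter_upwards [h] with t ht
    refine (ht.add ((integrable_wigner hρW t).const_mul m)).congr
      (Eventually.of_forall fun E => ?_)
    simp only [Pi.add_apply]
    ring
  filter_upwards [wignerCurveDeriv_ae_eq hρW hE, coeFn_wignerCurve hρW 0,
    Lp.coeFn_sub ((-Complex.I) • wignerCurveDeriv ρW) (m • wignerCurve ρW 0),
    Lp.coeFn_smul (-Complex.I) (wignerCurveDeriv ρW), Lp.coeFn_smul m (wignerCurve ρW 0),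
    ae_comp_two_pi_mul hE]
    with τ h1 h2 h3 h4 h5 h6
  have h7 : ∫ E : ℝ, ((E : ℂ) - m) * wigner ρW E (2 * Real.pi * τ) =
      (∫ E : ℝ, (E : ℂ) * wigner ρW E (2 * Real.pi * τ)) -
        m * wignerTransform ρW 0 (2 * Real.pi * τ) := by
    simp only [sub_mul]
    rw [integral_sub h6 ((integrable_wigner hρW _).const_mul m), integral_const_mul]
    simp [wignerTransform]
  rw [h3, Pi.sub_apply, h4, h5, Pi.smul_apply, Pi.smul_apply, h1, h2, h7, smul_eq_mul, smul_eq_mul]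
  linear_combination (-(2 * Real.pi * ∫ E : ℝ, (E : ℂ) * wigner ρW E (2 * Real.pi * τ))) *
    Complex.I_mul_I

/-- The centered moment `D` has an `L¹` representative, hence is integrable with Fourier
coefficients `e(ω) - e(0) o(ω)`. As `Tr[W_S(t) ρ_S]` is a finite trigonometric sum in `t`, the
integral reads off these coefficients at the gaps. -/
theorem integrable_and_fTerm_eq_integral (hρW : ρW.FiniteSecondMoment weightH) (ε : n → ℝ)
    (V : Matrix n n ℂ) (h : ∀ᵐ t : ℝ, Integrable fun E : ℝ =>
      ((E : ℂ) - energyOverlap ρW 0) * wigner ρW E t) :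
    (Integrable fun t : ℝ => (workOpAt ε V t * densityMatrix ρS).trace *
      ∫ E : ℝ, ((E : ℂ) - energyOverlap ρW 0) * wigner ρW E t) ∧
    fTerm ε V ρS ρW = ∫ t : ℝ, (workOpAt ε V t * densityMatrix ρS).trace *
      ∫ E : ℝ, ((E : ℂ) - energyOverlap ρW 0) * wigner ρW E t := by
  have hae := coeFn_centered_ae_eq hρW _ h
  set D : ℝ → ℂ := fun t => ∫ E : ℝ, ((E : ℂ) - energyOverlap ρW 0) * wigner ρW E t with hD
  have hDi : Integrable D := integrable_of_coeFn_ae_eq hae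
  have hDω : ∀ ω : ℝ, ∫ t : ℝ, Complex.exp (-(Complex.I * ω * t)) * D t =
      energyOverlap ρW ω - energyOverlap ρW 0 * overlap ρW ω := fun ω => by
    rw [integral_exp_mul_of_coeFn_ae_eq ω hae, map_sub, map_smul, map_smul,
      fourierCoeff_wignerCurveDeriv hρW, fourierCoeff_wignerCurve_zero hρW, smul_eq_mul,
      smul_eq_mul]
    linear_combination (-energyOverlap ρW ω) * Complex.I_mul_I
  have hterm : ∀ i j, Integrable fun t : ℝ => workOp ε V i j * densityMatrix ρS j i *
      (Complex.exp (-(Complex.I * (ε j - ε i : ℝ) * t)) * D t) := fun i j =>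
    (hDi.bdd_mul (c := 1) (by fun_prop)
      (Eventually.of_forall fun t => (norm_exp_neg_phase _ t).le)).const_mul _
  have hsum : ∀ t, (workOpAt ε V t * densityMatrix ρS).trace * D t = ∑ i, ∑ j,
      workOp ε V i j * densityMatrix ρS j i *
      (Complex.exp (-(Complex.I * (ε j - ε i : ℝ) * t)) * D t) := fun t => by
    rw [trace_workOpAt_mul, Finset.sum_mul]
    refine Finset.sum_congr rfl fun i _ => ?_
    rw [Finset.sum_mul]
    refine Finset.sum_congr rfl fun j _ => ?_
    ring
  change (Integrable fun t => (workOpAt ε V t * densityMatrix ρS).trace * D t) ∧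
    _ = ∫ t, (workOpAt ε V t * densityMatrix ρS).trace * D t
  simp only [hsum]
  refine ⟨integrable_finsetSum _ fun i _ => integrable_finsetSum _ fun j _ => hterm i j, ?_⟩
  rw [integral_finsetSum _ fun i _ => integrable_finsetSum _ fun j _ => hterm i j]
  simp only [fTerm_eq_weightedTrace hρW, weightedTrace, Finset.mul_sum, ← Finset.sum_sub_distrib]
  refine Finset.sum_congr rfl fun i _ => ?_
  rw [integral_finsetSum _ fun j _ => hterm i j]
  refine Finset.sum_congr rfl fun j _ => ?_
  rw [integral_const_mul, hDω]
  ring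

end Result

end QWeight

end

/-! ### The theorem -/

theorem theorem1 {n κ ι : Type*} [Fintype n] [DecidableEq n] [Countable κ] [Countable ι]
    (ε : n → ℝ) (V : Matrix n n ℂ) (hV : V ∈ Matrix.unitaryGroup n ℂ)
    (ρS : QWeight.MixedState κ (EuclideanSpace ℂ n))
    (ρW : QWeight.MixedState ι QWeight.WeightSpace)
    (hρW : ρW.FiniteSecondMoment QWeight.weightH) :
    -- the observables involved have finite second moments
    ((QWeight.prodState ρS ρW).FiniteSecondMoment (QWeight.onWeight QWeight.weightH) ∧
      (QWeight.prodState ρS ρW).FiniteSecondMoment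
        (QWeight.heisenberg (QWeight.totalU ε V) (QWeight.onWeight QWeight.weightH)) ∧
      (QWeight.controlState ε ρS ρW).FiniteSecondMoment
        (QWeight.ofBounded (QWeight.onSystem (QWeight.systemH ε)) -
          QWeight.onWeight QWeight.weightH)) ∧
    -- the changes of the mean energy and of the energy variance
    QWeight.deltaE ε V ρS ρW =
      QWeight.matExpect (QWeight.controlMarginal ε ρS ρW) (QWeight.workOp ε V) ∧
    QWeight.deltaVar ε V ρS ρW =
      QWeight.matVar (QWeight.controlMarginal ε ρS ρW) (QWeight.workOp ε V) +
        2 * QWeight.fTerm ε V ρS ρW ∧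
    -- the integrals that define `ξ_S(s)` converge, and `F = -i Tr[W_S ξ_S'(0)]`
    ((∀ᵐ t : ℝ, Integrable fun E : ℝ => QWeight.wigner ρW E t) ∧
      (∀ s : ℝ, Integrable fun t : ℝ =>
        ∫ E : ℝ, Complex.exp (Complex.I * E * s) * QWeight.wigner ρW E t) ∧
      (∀ i j, DifferentiableAt ℝ (fun s => QWeight.xi ε ρS ρW s i j) 0) ∧
      QWeight.fTerm ε V ρS ρW =
        -Complex.I * (QWeight.workOp ε V * QWeight.xiDerivZero ε ρS ρW).trace) ∧
    -- the Wigner form of `F`, whenever its inner integral converges for almost every `t`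
    ((∀ᵐ t : ℝ, Integrable fun E : ℝ =>
        ((E : ℂ) - (QWeight.prodState ρS ρW).expect (QWeight.onWeight QWeight.weightH)) *
          QWeight.wigner ρW E t) →
      (Integrable fun t : ℝ =>
        (QWeight.workOpAt ε V t * QWeight.densityMatrix ρS).trace *
          ∫ E : ℝ,
            ((E : ℂ) - (QWeight.prodState ρS ρW).expect (QWeight.onWeight QWeight.weightH)) *
              QWeight.wigner ρW E t) ∧
      QWeight.fTerm ε V ρS ρW =
        ∫ t : ℝ, (QWeight.workOpAt ε V t * QWeight.densityMatrix ρS).trace *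
          ∫ E : ℝ,
            ((E : ℂ) - (QWeight.prodState ρS ρW).expect (QWeight.onWeight QWeight.weightH)) *
              QWeight.wigner ρW E t) := by
  refine ⟨⟨QWeight.finiteSecondMoment_onWeight hρW,
    QWeight.finiteSecondMoment_heisenberg hρW ε hV,
    QWeight.finiteSecondMoment_systemH_sub_weightH hρW ε⟩,
    QWeight.deltaE_eq hρW ε hV, QWeight.deltaVar_eq hρW ε hV,
    ⟨Filter.Eventually.of_forall fun t => QWeight.integrable_wigner hρW t,
      fun s => QWeight.integrable_wignerTransform hρW s,
      fun i j => (QWeight.hasDerivAt_xi hρW ε i j).differentiableAt,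
      QWeight.fTerm_eq_trace_xiDerivZero hρW ε V⟩, fun h => ?_⟩
  rw [QWeight.expect_onWeight hρW] at h ⊢
  exact QWeight.integrable_and_fTerm_eq_integral hρW ε V h
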